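/- Let $d\in\{2,3\}$. Consider $n$ points $p=(p_1,\dots,p_n)\in\mathbb{R}^{dn}$, a finite set $\mathcal E$ of undirected edges $\{i,j\}$ with $i\ne j$ (distance constraints) and a finite set $\mathcal A$ of triples $(k,i,j)$ of pairwise distinct vertices (angle constraints). Where all angles are defined (that is, $p_k\neq p_i$ and $p_k\ne p_j$ for $(k,i,j)\in\mathcal A$), let $F_W(p)=\big[\dots,\|p_i-p_j\|^2,\dots,\cos\theta^k_{ij}(p),\dots\big]^\top$, where $\theta^k_{ij}$ is the angle at $p_k$ between the segments to $p_i$ and $p_j$, and let $R_W(p)=\partial F_W/\partial p$. A motion $v$ is trivial at $p$ if $v_i=b+Jp_i+s\,p_i$ for all $i$, with $b\in\mathbb R^d$, $J$ skew-symmetric and $s\in\mathbb R$, where $s=0$ if $\mathcal E\ne\emptyset$. The framework $(\mathcal E,\mathcal A,p)$ is GIWR if every $v$ with $R_W(p)v=0$ is trivial; it is minimally GIWR if moreover, after removal of any single distance or angle constraint, the remaining constraints admit an infinitesimal motion that is not a trivial motion of the framework. Let $q$ be a configuration at which all angles in $\mathcal A$ are defined and such that the desired formation $(\mathcal E,\mathcal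 A,q)$ is GIWR but not minimally GIWR, and let $e(p)=F_W(p)-F_W(q)$. Then $(\mathcal E,\mathcal A,q)$ has a minimally GIWR sub-framework $(\bar{\mathcal E},\bar{\mathcal A},q)$ with $\bar{\mathcal E}\subseteq\mathcal E$, $\bar{\mathcal A}\subseteq\mathcal A$, and $\bar{\mathcal E}\neq\emptyset$ if $\mathcal E\ne\emptyset$. For every such sub-framework, let $\bar e,\bar R$ be the parts of $e,R_W$ belonging to $(\bar{\mathcal E},\bar{\mathcal A})$, and $\tilde e,\tilde R$ those belonging to $(\mathcal E\setminus\bar{\mathcal E},\mathcal A\setminus\bar{\mathcal A})$. (1) There is a function $f$, $C^\infty$ on an open neighbourhood of $0$, with $\tilde e(p)=f(\bar e(p))$ for all $p$ close to $q$; every such $f$ satisfies $f(0)=0$. (2) For every such $f$, the perturbed error system $$\dot{\bar e}=-\bar R\bar R^\top\bar e-\bar R\tilde R^\top f(\bar e)$$ under the gradient flow law $\dot p=-\nabla\big(\tfrac12 e^\top e\big)=-R_W(p)^\top e(p)$ has an exponentially stable equilibrium at the origin. Precisely, there are $\delta,K,r>0$ and a neighbourhood $V$ of $q$, with $\{x:\|x\|<\delta\}\subseteq\bar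 e(V)$, such that for every $p_0\in V$ the gradient flow has a solution with $p(0)=p_0$ on $[0,\infty)$, and for every such solution $p$: for all $t\ge0$ the angles in $\mathcal A$ are defined at $p(t)$, $\tilde e(p(t))=f(\bar e(p(t)))$, the function $\bar e(p(t))$ satisfies the perturbed error system, and $\|\bar e(p(t))\|\le K\|\bar e(p_0)\|e^{-rt}$; moreover, for the system $\dot x=-\bar R(p(t))\bar R(p(t))^\top x-\bar R(p(t))\tilde R(p(t))^\top f(x)$, $t\ge 0$, the origin is an equilibrium, and for every $t_0\ge0$ and $\|x_0\|<\delta$ there is a solution on $[t_0,\infty)$ with $x(t_0)=x_0$, and every solution with $x(t_0)=x_0$ on an interval $[t_0,T)$ satisfies $\|x(t)\|\le K\|x_0\|e^{-r(t-t_0)}$ there. -/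

import Mathlib

open scoped ContDiff

noncomputable section

/-- Configurations `p = (p_1, …, p_n)` of `n` points of `ℝ^d`: the Euclidean space `ℝ^{dn}`. -/
abbrev Config (n d : ℕ) : Type := EuclideanSpace ℝ (Fin n × Fin d)

/-- The position `p_i` of vertex `i`. -/
def pos {n d : ℕ} (p : Config n d) (i : Fin n) : EuclideanSpace ℝ (Fin d) :=
  WithLp.toLp 2 (fun c => p (i, c))

/-- The Euclidean space `ℝ^{m+w}` whose coordinates are the distance constraints (undirected edges)
in `E` and the angle constraints `(k, i, j)` in `A`. -/
abbrev ErrorSpace {n : ℕ} (E : Finset (Sym2 (Fin n))) (A : Finset (Fin n × Fin n × Fin n)) : Type :=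
  EuclideanSpace ℝ (E ⊕ A)

/-- The squared length `‖p_i - p_j‖²` of an undirected edge `{i, j}`. -/
def sqLength {n d : ℕ} (p : Config n d) : Sym2 (Fin n) → ℝ :=
  Sym2.lift ⟨fun i j => ‖pos p i - pos p j‖ ^ 2, fun i j => by simp only [norm_sub_rev]⟩

/-- The cosine of the angle at vertex `k` between the segments `k i` and `k j`, for `(k, i, j)`. -/
def cosAngle {n d : ℕ} (p : Config n d) (a : Fin n × Fin n × Fin n) : ℝ :=
  Real.cos (EuclideanGeometry.angle (pos p a.2.1) (pos p a.1) (pos p a.2.2))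

/-- The weak rigidity function `F_W`: squared lengths of the edges and cosines of the angles. -/
def weakRigidityFun {n d : ℕ} (E : Finset (Sym2 (Fin n))) (A : Finset (Fin n × Fin n × Fin n))
    (p : Config n d) : ErrorSpace E A :=
  WithLp.toLp 2 (Sum.elim (fun e : E => sqLength p e) (fun a : A => cosAngle p a))

/-- The configurations at which all angles of `A` are defined (no vanishing denominator). -/
def angleDomain {n : ℕ} (d : ℕ) (A : Finset (Fin n × Fin n × Fin n)) : Set (Config n d) :=
  {p | ∀ a ∈ A, pos p a.1 ≠ pos p a.2.1 ∧ pos p a.1 ≠ pos p a.2.2}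

/-- `(𝒢, 𝒜, p)` is a framework: edges join distinct vertices, angles have three distinct vertices
and are defined at `p`. -/
def IsFramework {n d : ℕ} (E : Finset (Sym2 (Fin n))) (A : Finset (Fin n × Fin n × Fin n))
    (p : Config n d) : Prop :=
  (∀ e ∈ E, ¬ e.IsDiag) ∧
  (∀ a ∈ A, a.1 ≠ a.2.1 ∧ a.1 ≠ a.2.2 ∧ a.2.1 ≠ a.2.2) ∧
  p ∈ angleDomain d A

/-- The weak rigidity matrix `R_W(p)`, the Jacobian of `F_W` at `p`, as a linear map. Its transpose
is the adjoint with respect to the Euclidean inner products. -/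
def weakRigidityMatrix {n d : ℕ} (E : Finset (Sym2 (Fin n))) (A : Finset (Fin n × Fin n × Fin n))
    (p : Config n d) : Config n d →L[ℝ] ErrorSpace E A :=
  fderiv ℝ (weakRigidityFun E A) p

/-- Trivial infinitesimal motions: a translation plus an infinitesimal rotation (given by a
skew-symmetric matrix), plus, if and only if there are no distance constraints, a scaling. -/
def IsTrivialMotion {n d : ℕ} (E : Finset (Sym2 (Fin n))) (p v : Config n d) : Prop :=
  ∃ (b : EuclideanSpace ℝ (Fin d)) (J : Matrix (Fin d) (Fin d) ℝ) (s : ℝ),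
    J.transpose = -J ∧ (E.Nonempty → s = 0) ∧
    ∀ i, pos v i = b + WithLp.toLp 2 (J.mulVec (pos p i)) + s • pos p i

/-- Generalized infinitesimal weak rigidity: every infinitesimal motion is trivial. -/
def IsGIWR {n d : ℕ} (E : Finset (Sym2 (Fin n))) (A : Finset (Fin n × Fin n × Fin n))
    (p : Config n d) : Prop :=
  ∀ v : Config n d, weakRigidityMatrix E A p v = 0 → IsTrivialMotion E p v

/-- Minimal GIWR: the framework is GIWR, and the removal of any single distance or angle constraint
admits an infinitesimal motion that is not a trivial motion of the framework. (Triviality always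
refers to the given framework, so the only edge of a framework cannot be dropped for free.) -/
def IsMinimallyGIWR {n d : ℕ} (E : Finset (Sym2 (Fin n))) (A : Finset (Fin n × Fin n × Fin n))
    (p : Config n d) : Prop :=
  IsGIWR E A p ∧
  (∀ e ∈ E, ∃ v : Config n d,
    weakRigidityMatrix (E.erase e) A p v = 0 ∧ ¬ IsTrivialMotion E p v) ∧
  (∀ a ∈ A, ∃ v : Config n d,
    weakRigidityMatrix E (A.erase a) p v = 0 ∧ ¬ IsTrivialMotion E p v)

/-- `(E', A')` is a minimally GIWR sub-framework of `(E, A)` at `p`, with the same trivial motions: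
it retains a distance constraint if `(E, A)` has one. -/
def IsMinimallyGIWRSub {n d : ℕ} (E : Finset (Sym2 (Fin n))) (A : Finset (Fin n × Fin n × Fin n))
    (E' : Finset (Sym2 (Fin n))) (A' : Finset (Fin n × Fin n × Fin n)) (p : Config n d) : Prop :=
  E' ⊆ E ∧ A' ⊆ A ∧ (E.Nonempty → E'.Nonempty) ∧ IsMinimallyGIWR E' A' p

/-- The error vector `e(p) = F_W(p) - F_W(q)` with respect to the desired configuration `q`. -/
def errorVec {n d : ℕ} (E : Finset (Sym2 (Fin n))) (A : Finset (Fin n × Fin n × Fin n))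
    (q p : Config n d) : ErrorSpace E A :=
  weakRigidityFun E A p - weakRigidityFun E A q

/-- `p` solves the gradient flow law `ṗ = -∇ (½ eᵀ e)` for all times `t ≥ 0`. -/
def IsGradientFlow {n d : ℕ} (E : Finset (Sym2 (Fin n))) (A : Finset (Fin n × Fin n × Fin n))
    (q : Config n d) (p : ℝ → Config n d) : Prop :=
  ∀ t, 0 ≤ t → HasDerivWithinAt p
    (-gradient (fun x : Config n d => (1 / 2 : ℝ) * ‖errorVec E A q x‖ ^ 2) (p t)) (Set.Ici 0) t

/-- Locally near `q`, the remaining errors are given by the smooth function `f` of the errors of the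
sub-framework `(E', A')`: `f` is smooth on an open neighbourhood of `0`, and `ẽ(p) = f(ē(p))` for
all `p` close to `q`. -/
def IsErrorFunction {n d : ℕ} (E : Finset (Sym2 (Fin n))) (A : Finset (Fin n × Fin n × Fin n))
    (E' : Finset (Sym2 (Fin n))) (A' : Finset (Fin n × Fin n × Fin n)) (q : Config n d)
    (f : ErrorSpace E' A' → ErrorSpace (E \ E') (A \ A')) : Prop :=
  (∃ U : Set (ErrorSpace E' A'), IsOpen U ∧ 0 ∈ U ∧ ContDiffOn ℝ ∞ f U) ∧
  ∀ᶠ p in nhds q, errorVec (E \ E') (A \ A') q p = f (errorVec E' A' q p)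

/-- The right-hand side `-R̄(p) R̄(p)ᵀ x - R̄(p) R̃(p)ᵀ f(x)` of the perturbed error system. -/
def perturbedField {n d : ℕ} (E : Finset (Sym2 (Fin n))) (A : Finset (Fin n × Fin n × Fin n))
    (E' : Finset (Sym2 (Fin n))) (A' : Finset (Fin n × Fin n × Fin n))
    (f : ErrorSpace E' A' → ErrorSpace (E \ E') (A \ A')) (p : Config n d)
    (x : ErrorSpace E' A') : ErrorSpace E' A' :=
  -weakRigidityMatrix E' A' p (ContinuousLinearMap.adjoint (weakRigidityMatrix E' A' p) x)
    - weakRigidityMatrix E' A' p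
        (ContinuousLinearMap.adjoint (weakRigidityMatrix (E \ E') (A \ A') p) (f x))

/-- The origin is an exponentially stable equilibrium of the (time-varying) system `ẋ = g(t, x)`,
`t ≥ 0`, with radius `δ`, gain `K` and rate `r`: the origin is an equilibrium; every initial value
of norm less than `δ` at any initial time `t₀ ≥ 0` has a solution on `[t₀, ∞)`; and every solution
on an interval `[t₀, T)` with such an initial value satisfies
`‖x(t)‖ ≤ K ‖x(t₀)‖ exp(-r (t - t₀))`. -/
def IsExpStableAtOrigin {X : Type*} [NormedAddCommGroup X] [NormedSpace ℝ X] (g : ℝ → X → X)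
    (δ K r : ℝ) : Prop :=
  (∀ t, 0 ≤ t → g t 0 = 0) ∧
  ∀ t₀, 0 ≤ t₀ → ∀ x₀ : X, ‖x₀‖ < δ →
    (∃ x : ℝ → X, x t₀ = x₀ ∧
      ∀ t, t₀ ≤ t → HasDerivWithinAt x (g t (x t)) (Set.Ici t₀) t) ∧
    ∀ (T : ℝ) (x : ℝ → X), x t₀ = x₀ →
      (∀ t ∈ Set.Ico t₀ T, HasDerivWithinAt x (g t (x t)) (Set.Ici t₀) t) →
      ∀ t ∈ Set.Ico t₀ T, ‖x t‖ ≤ K * ‖x₀‖ * Real.exp (-r * (t - t₀))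

end

/-! Write `R`, `S` for the rigidity matrices of the sub-framework and of the remaining constraints,
and `a`, `b` for their error maps.

Minimality makes `R q` surjective: dropping a constraint admits a nontrivial motion, which by GIWR
that constraint must detect, so some vector is mapped to each basis vector
(`IsMinimallyGIWR.surjective`). Hence `a` is a submersion at `q`. The kernel of `R q` consists of
trivial motions, and these extend continuously to nearby `p` as trivial motions, killed by both `R
p` and `S p`. By semicontinuity of the rank they span `ker (R p)`, so `ker (R p) ≤ ker (S p)` near
`q` (`eventually_ker_le_of_continuousAt_sections`). Thus `b` is constant on the local fibres of `a`,
that is, `b = f ∘ a` (`exists_contDiffAt_eventually_eq_comp_of_ker_le`).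

For stability put `D = Df(0)`. The chain rule gives `S q = D R`, so the linearized error system at
`q` is `ẋ = -R Rᵀ P x` with `P = 1 + Dᵀ D`. The form `⟨P x, x⟩` is a Lyapunov function: half its
derivative is `-‖Rᵀ P x‖²`, negative definite because `Rᵀ` and `P` are injective
(`exists_pos_le_inner_of_surjective`). The estimate persists for `p` near `q` and small `x`. The
flow stays near `q` because its speed is bounded by a multiple of the exponentially decaying error,
hence integrable (`mem_ball_of_flow`, `exists_expStable_of_lyapunov`).

A minimal sub-framework is an inclusion-minimal GIWR one that keeps an edge if there was one. -/

/-! ### Quadratic decay estimates and confinement of trajectories -/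

/-- A continuous function that is below `ρ` whenever it has been below `ρ` so far stays below. -/
theorem lt_of_forall_lt_imp_lt {φ : ℝ → ℝ} {t₀ T ρ : ℝ} (hc : ContinuousOn φ (Set.Ico t₀ T))
    (h : ∀ t ∈ Set.Ico t₀ T, (∀ s ∈ Set.Ico t₀ t, φ s < ρ) → φ t < ρ) :
    ∀ t ∈ Set.Ico t₀ T, φ t < ρ := by
  intro t ht
  by_contra! hlt
  have hsub : Set.Icc t₀ t ⊆ Set.Ico t₀ T := fun s hs => ⟨hs.1, hs.2.trans_lt ht.2⟩
  have hcl : IsClosed {s | s ∈ Set.Icc t₀ t ∧ ρ ≤ φ s} := by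
    have := (hc.mono hsub).preimage_isClosed_of_isClosed isClosed_Icc (isClosed_Ici (a := ρ))
    exact this
  have hcpt : IsCompact {s | s ∈ Set.Icc t₀ t ∧ ρ ≤ φ s} :=
    isCompact_Icc.of_isClosed_subset hcl fun s hs => hs.1
  -- The first time at which `φ` reaches `ρ`: before it `φ < ρ`, so `h` applies there.
  obtain ⟨m, hm, hmin⟩ := hcpt.exists_isLeast ⟨t, ⟨ht.1, le_rfl⟩, hlt⟩
  refine absurd (h m (hsub hm.1) fun s hs => ?_) (not_lt.2 hm.2)
  by_contra! hs'
  exact absurd (hmin ⟨⟨hs.1, hs.2.le.trans hm.1.2⟩, hs'⟩) (not_le.2 hs.2)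

/-- A differential inequality for a quadratic form equivalent to the squared norm gives exponential
decay. -/
theorem norm_le_exp_of_quadratic_deriv_le {X : Type*} [NormedAddCommGroup X]
    [InnerProductSpace ℝ X] {P : X →L[ℝ] X} (hPs : ∀ x y, inner ℝ (P x) y = inner ℝ x (P y))
    (hP : ∀ x, ‖x‖ ^ 2 ≤ inner ℝ (P x) x) {M c : ℝ} (hM : 1 ≤ M) (hPM : ‖P‖ ≤ M) (hc : 0 < c)
    {t₀ t : ℝ} (ht : t₀ ≤ t) {x : ℝ → X} (hx : ContinuousOn x (Set.Icc t₀ t))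
    (hd : ∀ s ∈ Set.Ico t₀ t, ∃ v, HasDerivWithinAt x v (Set.Ici t₀) s ∧
      inner ℝ (P (x s)) v ≤ -c * ‖x s‖ ^ 2) :
    ‖x t‖ ≤ M * ‖x t₀‖ * Real.exp (-(c / M) * (t - t₀)) := by
  have hM0 : 0 < M := by linarith
  have hup : ∀ y, inner ℝ (P y) y ≤ M * ‖y‖ ^ 2 := fun y => by
    calc inner ℝ (P y) y ≤ ‖P y‖ * ‖y‖ := real_inner_le_norm _ _
      _ ≤ (M * ‖y‖) * ‖y‖ := by
        gcongr
        exact (P.le_opNorm y).trans (by gcongr)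
      _ = _ := by ring
  set r := c / M with hr
  -- The exponential weight costs `2r⟨P x, x⟩ ≤ 2c‖x‖²`, exactly what the decay of the form pays, so
  -- `W` is antitone.
  let W : ℝ → ℝ := fun s => inner ℝ (P (x s)) (x s) * Real.exp (2 * r * (s - t₀))
  have hWc : ContinuousOn W (Set.Icc t₀ t) := by
    have := P.continuous.comp_continuousOn hx
    fun_prop
  have hWd : ∀ s ∈ Set.Ioo t₀ t, ∃ w ≤ 0, HasDerivAt W w s := by
    intro s hs
    obtain ⟨v, hv, hle⟩ := hd s ⟨hs.1.le, hs.2⟩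
    have hv' : HasDerivAt x v s := hv.hasDerivAt (Ici_mem_nhds hs.1)
    have h1 : HasDerivAt (fun s => P (x s)) (P v) s := P.hasFDerivAt.comp_hasDerivAt s hv'
    have h2 := h1.inner ℝ hv'
    have h3 : HasDerivAt (fun s => Real.exp (2 * r * (s - t₀)))
        (Real.exp (2 * r * (s - t₀)) * (2 * r * 1)) s :=
      (((hasDerivAt_id s).sub_const t₀).const_mul (2 * r)).exp
    refine ⟨_, ?_, h2.mul h3⟩
    rw [hPs v (x s), real_inner_comm (P (x s)) v]
    have h4 : r * inner ℝ (P (x s)) (x s) ≤ c * ‖x s‖ ^ 2 := by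
      calc r * inner ℝ (P (x s)) (x s) ≤ r * (M * ‖x s‖ ^ 2) := by
            gcongr
            exact hup _
        _ = _ := by rw [hr]; field_simp
    have h5 := Real.exp_pos (2 * r * (s - t₀))
    nlinarith
  have hanti : AntitoneOn W (Set.Icc t₀ t) := by
    refine antitoneOn_of_deriv_nonpos (convex_Icc _ _) hWc ?_ ?_ <;> rw [interior_Icc]
    · intro s hs
      obtain ⟨w, -, hw⟩ := hWd s hs
      exact hw.differentiableAt.differentiableWithinAt
    · intro s hs
      obtain ⟨w, h0, hw⟩ := hWd s hs
      rwa [hw.deriv]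
  have h1 := hanti (Set.left_mem_Icc.2 ht) (Set.right_mem_Icc.2 ht) ht
  simp only [W, sub_self, mul_zero, Real.exp_zero, mul_one] at h1
  have h2 : ‖x t‖ ^ 2 * Real.exp (2 * r * (t - t₀)) ≤ M * ‖x t₀‖ ^ 2 := by
    refine le_trans ?_ (h1.trans (hup _))
    gcongr
    exact hP _
  have h3 : Real.exp (2 * r * (t - t₀)) = Real.exp (r * (t - t₀)) ^ 2 := by
    rw [← Real.exp_nat_mul]; congr 1; push_cast; ring
  rw [neg_mul, Real.exp_neg, ← div_eq_mul_inv, le_div_iff₀ (Real.exp_pos _)]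
  refine le_of_sq_le_sq ?_ (by positivity)
  rw [mul_pow, ← h3, mul_pow]
  refine h2.trans ?_
  -- What remains is `M ≤ M ^ 2`: the gain `√M` is coarsened to `M`.
  gcongr
  nlinarith

/-- Trajectories along which the quadratic form decays as long as they are in a ball stay in the
ball. -/
theorem norm_lt_and_le_exp_of_quadratic_deriv_le {X : Type*} [NormedAddCommGroup X]
    [InnerProductSpace ℝ X] {P : X →L[ℝ] X} (hPs : ∀ x y, inner ℝ (P x) y = inner ℝ x (P y))
    (hP : ∀ x, ‖x‖ ^ 2 ≤ inner ℝ (P x) x) {M c ε : ℝ} (hM : 1 ≤ M) (hPM : ‖P‖ ≤ M) (hc : 0 < c)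
    {t₀ T : ℝ} {x : ℝ → X} (hx : ContinuousOn x (Set.Ico t₀ T)) (h0 : M * ‖x t₀‖ < ε)
    (hd : ∀ s ∈ Set.Ico t₀ T, ‖x s‖ < ε → ∃ v, HasDerivWithinAt x v (Set.Ici t₀) s ∧
      inner ℝ (P (x s)) v ≤ -c * ‖x s‖ ^ 2) :
    ∀ t ∈ Set.Ico t₀ T, ‖x t‖ < ε ∧ ‖x t‖ ≤ M * ‖x t₀‖ * Real.exp (-(c / M) * (t - t₀)) := by
  have key : ∀ t ∈ Set.Ico t₀ T, (∀ s ∈ Set.Ico t₀ t, ‖x s‖ < ε) →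
      ‖x t‖ ≤ M * ‖x t₀‖ * Real.exp (-(c / M) * (t - t₀)) := fun t ht hs =>
    norm_le_exp_of_quadratic_deriv_le hPs hP hM hPM hc ht.1
      (hx.mono fun s hs => ⟨hs.1, hs.2.trans_lt ht.2⟩)
      fun s hs' => hd s ⟨hs'.1, hs'.2.trans ht.2⟩ (hs s hs')
  -- Bootstrap: the decay bound at `t` needs only earlier times, and is at most `M * ‖x t₀‖ < ε`.
  have hlt := lt_of_forall_lt_imp_lt (ρ := ε) hx.norm fun t ht hs => by
    refine (key t ht hs).trans_lt (lt_of_le_of_lt ?_ h0)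
    refine mul_le_of_le_one_right (by positivity) (Real.exp_le_one_iff.2 ?_)
    have : 0 ≤ c / M * (t - t₀) := mul_nonneg (by positivity) (sub_nonneg.2 ht.1)
    linarith
  exact fun t ht => ⟨hlt t ht, key t ht fun s hs => hlt s ⟨hs.1, hs.2.trans ht.2⟩⟩

/-- A trajectory whose speed is bounded by a decaying output `‖a (p t)‖` stays near its start. -/
theorem mem_ball_of_flow {X Y : Type*} [NormedAddCommGroup X] [InnerProductSpace ℝ X]
    [NormedAddCommGroup Y] [NormedSpace ℝ Y] {P : X →L[ℝ] X}
    (hPs : ∀ x y, inner ℝ (P x) y = inner ℝ x (P y))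
    (hP : ∀ x, ‖x‖ ^ 2 ≤ inner ℝ (P x) x) {M c C ρ : ℝ} (hM : 1 ≤ M) (hPM : ‖P‖ ≤ M)
    (hc : 0 < c) (hC : 0 < C) {q : Y} {a : Y → X} {G : Y → Y}
    (ha : ∀ y ∈ Metric.ball q ρ, DifferentiableAt ℝ a y)
    (hdec : ∀ y ∈ Metric.ball q ρ, inner ℝ (P (a y)) (fderiv ℝ a y (G y)) ≤ -c * ‖a y‖ ^ 2)
    (hG : ∀ y ∈ Metric.ball q ρ, ‖G y‖ ≤ C * ‖a y‖) {p : ℝ → Y}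
    (hp : ContinuousOn p (Set.Ici 0))
    (hd : ∀ t, 0 ≤ t → p t ∈ Metric.ball q ρ → HasDerivWithinAt p (G (p t)) (Set.Ici 0) t)
    (h0 : dist (p 0) q + C * (M * ‖a (p 0)‖) / (c / M) < ρ) :
    ∀ t, 0 ≤ t → p t ∈ Metric.ball q ρ := by
  have hM0 : 0 < M := by linarith
  have hr : 0 < c / M := by positivity
  set r := c / M with hrdef
  intro t ht
  have hc' : ContinuousOn (fun t => dist (p t) q) (Set.Ico 0 (t + 1)) :=
    (continuous_id.dist continuous_const).comp_continuousOn (hp.mono Set.Ico_subset_Ici_self)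
  refine lt_of_forall_lt_imp_lt hc' (fun s hs hlt => ?_) t ⟨ht, by linarith⟩
  have hdec' : ∀ u ∈ Set.Ico 0 s, ‖a (p u)‖ ≤ M * ‖a (p 0)‖ * Real.exp (-r * (u - 0)) := by
    intro u hu
    refine norm_le_exp_of_quadratic_deriv_le (x := fun u => a (p u)) hPs hP hM hPM hc hu.1 ?_ ?_
    · intro w hw
      have hw' : w ∈ Set.Ico 0 s := ⟨hw.1, hw.2.trans_lt hu.2⟩
      exact (ha _ (hlt w hw')).continuousAt.comp_continuousWithinAt
        ((hp w hw.1).mono fun z hz => hz.1)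
    · intro w hw
      have hw' : p w ∈ Metric.ball q ρ := hlt w ⟨hw.1, hw.2.trans hu.2⟩
      exact ⟨_, (ha _ hw').hasFDerivAt.comp_hasDerivWithinAt w (hd w hw.1 hw'), hdec _ hw'⟩
  -- The integral from `0` to `u` of the speed bound; its limit as `u → ∞` is the travel allowance
  -- in `h0`.
  let B : ℝ → ℝ := fun u => C * (M * ‖a (p 0)‖) / r * (1 - Real.exp (-r * u))
  have hB : ∀ u, HasDerivAt B (C * (M * ‖a (p 0)‖) * Real.exp (-r * u)) u := by
    intro u
    have h := ((((hasDerivAt_id u).const_mul (-r)).exp).const_sub 1).const_mul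
      (C * (M * ‖a (p 0)‖) / r)
    refine h.congr_deriv ?_
    simp only [id]
    field_simp
  have hdist : ‖p s - p 0‖ ≤ B s := by
    refine image_norm_le_of_norm_deriv_right_le_deriv_boundary' (f := fun u => p u - p 0)
      (f' := fun u => G (p u)) (a := 0) (b := s) ?_ ?_ ?_ ?_
      (fun u _ => (hB u).hasDerivWithinAt) ?_ (Set.right_mem_Icc.2 hs.1)
    · exact (hp.mono fun u hu => hu.1).sub continuousOn_const
    · intro u hu
      exact ((hd u hu.1 (hlt u hu)).mono (Set.Ici_subset_Ici.2 hu.1)).sub_const _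
    · simp [B]
    · exact fun u _ => (hB u).continuousAt.continuousWithinAt
    · intro u hu
      have := hdec' u hu
      rw [sub_zero] at this
      calc ‖G (p u)‖ ≤ C * ‖a (p u)‖ := hG _ (hlt u hu)
        _ ≤ C * (M * ‖a (p 0)‖ * Real.exp (-r * u)) := by gcongr
        _ = _ := by ring
  have hBs : B s ≤ C * (M * ‖a (p 0)‖) / r := by
    refine mul_le_of_le_one_right (by positivity) ?_
    linarith [Real.exp_pos (-r * s)]
  calc dist (p s) q ≤ dist (p s) (p 0) + dist (p 0) q := dist_triangle _ _ _
    _ ≤ C * (M * ‖a (p 0)‖) / r + dist (p 0) q := by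
        rw [dist_eq_norm (p s)]; linarith
    _ < ρ := by linarith

/-! ### Truncation, global existence and linearization -/

/-- A function that is `C¹` at a point agrees near it with a bounded Lipschitz function. -/
theorem ContDiffAt.exists_lipschitzWith_bounded_eventuallyEq {Y X : Type*} [NormedAddCommGroup Y]
    [NormedSpace ℝ Y] [FiniteDimensional ℝ Y] [NormedAddCommGroup X] [NormedSpace ℝ X]
    {h : Y → X} {y₀ : Y} (hh : ContDiffAt ℝ 1 h y₀) :
    ∃ (g : Y → X) (K L : NNReal), LipschitzWith K g ∧ (∀ y, ‖g y‖ ≤ L) ∧ g =ᶠ[nhds y₀] h := by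
  obtain ⟨ε, hε, hball⟩ := Metric.eventually_nhds_iff_ball.1 (hh.eventually (by simp))
  -- The support, of radius `ε / 2`, lies well inside the ball where `h` is `C¹`, so `χ • h` is
  -- globally `C¹`.
  let χ : ContDiffBump y₀ := ⟨ε / 4, ε / 2, by positivity, by linarith⟩
  let g : Y → X := fun y => χ y • h y
  have hcs : HasCompactSupport g := χ.hasCompactSupport.smul_right
  have hg : ContDiff ℝ 1 g := by
    rw [contDiff_iff_contDiffAt]
    intro y
    by_cases hy : y ∈ Metric.ball y₀ ε
    · exact χ.contDiff.contDiffAt.smul (hball y hy)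
    · have : g =ᶠ[nhds y] fun _ => 0 := by
        have hy' : y ∈ (tsupport χ)ᶜ := by
          rw [χ.tsupport_eq]
          intro h'
          exact hy (Metric.closedBall_subset_ball (show ε / 2 < ε by linarith) h')
        filter_upwards [(isClosed_tsupport χ).isOpen_compl.mem_nhds hy'] with z hz
        simp [g, image_eq_zero_of_notMem_tsupport hz]
      exact contDiffAt_const.congr_of_eventuallyEq this
  obtain ⟨K, hK⟩ := hg.lipschitzWith_of_hasCompactSupport hcs (by simp)
  obtain ⟨L, hL⟩ := hcs.exists_bound_of_continuous hg.continuous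
  refine ⟨g, K, L.toNNReal, hK, fun y => (hL y).trans (Real.le_coe_toNNReal L), ?_⟩
  filter_upwards [χ.eventuallyEq_one] with y hy
  simp [g, hy]

/-- Global existence for bounded Lipschitz vector fields. -/
theorem exists_forall_hasDerivWithinAt_of_lipschitz_of_bounded {X : Type*} [NormedAddCommGroup X]
    [NormedSpace ℝ X] [CompleteSpace X] {g : ℝ → X → X} {t₀ : ℝ} {K L : NNReal}
    (hlip : ∀ t, t₀ ≤ t → LipschitzWith K (g t)) (hbd : ∀ t, t₀ ≤ t → ∀ x, ‖g t x‖ ≤ L)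
    (hcont : ∀ x, ContinuousOn (fun t => g t x) (Set.Ici t₀)) (x₀ : X) :
    ∃ x : ℝ → X, x t₀ = x₀ ∧ ∀ t, t₀ ≤ t → HasDerivWithinAt x (g t (x t)) (Set.Ici t₀) t := by
  have hex : ∀ N : ℕ, ∃ x : ℝ → X, x t₀ = x₀ ∧ ∀ t ∈ Set.Icc t₀ (t₀ + N),
      HasDerivWithinAt x (g t (x t)) (Set.Icc t₀ (t₀ + N)) t := by
    intro N
    have hN : t₀ ≤ t₀ + N := by simp
    -- With speed at most `L`, a solution cannot leave the ball of radius `L * N` within time `N`,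
    -- so the whole interval is reached.
    have : IsPicardLindelof g (⟨t₀, Set.left_mem_Icc.2 hN⟩ : Set.Icc t₀ (t₀ + N)) x₀ (L * N) 0 L K :=
      { lipschitzOnWith := fun t ht => (hlip t ht.1).lipschitzOnWith
        continuousOn := fun x _ => (hcont x).mono fun t ht => ht.1
        norm_le := fun t ht x _ => hbd t ht.1 x
        mul_max_le := by simp }
    exact this.exists_eq_forall_mem_Icc_hasDerivWithinAt₀
  choose x hx0 hx using hex
  have hderiv : ∀ N : ℕ, ∀ t ∈ Set.Ico t₀ (t₀ + N),
      HasDerivWithinAt (x N) (g t (x N t)) (Set.Ici t₀) t := fun N t ht =>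
    (hx N t ⟨ht.1, ht.2.le⟩).mono_of_mem_nhdsWithin (by
      rw [← Set.Ici_inter_Iic]
      exact Filter.inter_mem self_mem_nhdsWithin (mem_nhdsWithin_of_mem_nhds (Iic_mem_nhds ht.2)))
  have hagree : ∀ N M : ℕ, N ≤ M → Set.EqOn (x N) (x M) (Set.Icc t₀ (t₀ + N)) := by
    intro N M hNM
    have hNM' : (N : ℝ) ≤ M := by exact_mod_cast hNM
    refine ODE_solution_unique_of_mem_Icc_right (v := g) (K := K) (s := fun _ => Set.univ)
      (fun t ht => (hlip t ht.1).lipschitzOnWith) (fun t ht => (hx N t ht).continuousWithinAt)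
      (fun t ht => (hderiv N t ht).mono (Set.Ici_subset_Ici.2 ht.1)) (fun _ _ => trivial)
      ?_ ?_ (fun _ _ => trivial) ((hx0 N).trans (hx0 M).symm)
    · exact fun t ht => (hx M t ⟨ht.1, ht.2.trans (by linarith)⟩).continuousWithinAt.mono
        (Set.Icc_subset_Icc_right (by linarith))
    · exact fun t ht => (hderiv M t ⟨ht.1, ht.2.trans_le (by linarith)⟩).mono
        (Set.Ici_subset_Ici.2 ht.1)
  -- By uniqueness the solutions on growing intervals agree, so each `t` may use the first integer
  -- length that reaches it.
  let y : ℝ → X := fun t => x ⌈t - t₀⌉₊ t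
  have hy : ∀ N : ℕ, ∀ t ∈ Set.Icc t₀ (t₀ + N), y t = x N t := by
    intro N t ht
    have h1 : ⌈t - t₀⌉₊ ≤ N := Nat.ceil_le.2 (by linarith [ht.2])
    exact hagree _ N h1 ⟨ht.1, by linarith [Nat.le_ceil (t - t₀)]⟩
  refine ⟨y, by rw [hy 0 t₀ (by simp), hx0], fun t ht => ?_⟩
  obtain ⟨N, hN⟩ := exists_nat_gt (t - t₀)
  have htN : t < t₀ + N := by linarith
  rw [hy N t ⟨ht, htN.le⟩]
  refine (hderiv N t ⟨ht, htN⟩).congr_of_eventuallyEq ?_ (hy N t ⟨ht, htN.le⟩)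
  filter_upwards [self_mem_nhdsWithin, mem_nhdsWithin_of_mem_nhds (Iic_mem_nhds htN)] with s hs hs'
  exact hy N s ⟨hs, hs'⟩

/-- A `C¹` field `h (p, x)` vanishing at `x = 0` is uniformly close to its linearization in `x`. -/
theorem eventually_norm_add_le_of_contDiffAt {X Y : Type*} [NormedAddCommGroup X] [NormedSpace ℝ X]
    [NormedAddCommGroup Y] [NormedSpace ℝ Y] {q : Y} {h : Y × X → X} (hh : ContDiffAt ℝ 1 h (q, 0))
    (h0 : ∀ᶠ y in nhds q, h (y, 0) = 0) {A₀ : X →L[ℝ] X}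
    (hA : HasFDerivAt (fun x => h (q, x)) (-A₀) 0) {η : ℝ} (hη : 0 < η) :
    ∀ᶠ z in nhds (q, (0 : X)), ‖h z + A₀ z.2‖ ≤ η * ‖z.2‖ := by
  have hs := hh.hasStrictFDerivAt (by simp)
  set Φ := fderiv ℝ h (q, 0)
  have hΦ : ∀ x, Φ (0, x) = -A₀ x := by
    have h1 : HasFDerivAt (fun x => h (q, x)) (Φ.comp (ContinuousLinearMap.inr ℝ Y X)) 0 :=
      HasFDerivAt.comp (g := h) (0 : X) hs.hasFDerivAt (hasFDerivAt_prodMk_right q 0)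
    intro x
    have := congrArg (fun T => T x) (h1.unique hA)
    simpa using this
  -- Strict differentiability allows comparing `z` with the moving base point `(z.1, 0)`, where `h`
  -- vanishes; this makes the estimate uniform in `z.1`.
  have h2 := hs.isLittleO.def hη
  have h3 : Filter.Tendsto (fun z : Y × X => (z, (z.1, (0 : X)))) (nhds (q, 0))
      (nhds ((q, 0), (q, 0))) := by
    have : Continuous (fun z : Y × X => (z, (z.1, (0 : X)))) := by fun_prop
    exact this.tendsto (q, 0)
  have h4 : Filter.Tendsto (fun z : Y × X => z.1) (nhds (q, 0)) (nhds q) :=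
    continuous_fst.tendsto (q, (0 : X))
  filter_upwards [h3.eventually h2, h4.eventually h0] with z hz hz0
  have e1 : z - (z.1, 0) = (0, z.2) := by ext <;> simp
  have e2 : ‖((0 : Y), z.2)‖ = ‖z.2‖ := by simp [Prod.norm_def]
  simp only [hz0, sub_zero, e1, hΦ, sub_neg_eq_add, e2] at hz
  exact hz

/-! ### Exponential stability along a flow -/

/-- Local exponential stability of the output `a` of a flow `ṗ = G p`, and of the time-varying
system `ẋ = h (p t, x)` that it satisfies, by a quadratic Lyapunov function. -/
theorem exists_expStable_of_lyapunov {X Y : Type*} [NormedAddCommGroup X] [InnerProductSpace ℝ X]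
    [FiniteDimensional ℝ X] [NormedAddCommGroup Y] [NormedSpace ℝ Y] [FiniteDimensional ℝ Y]
    {q : Y} {h : Y × X → X} {G : Y → Y} {a : Y → X} {P A₀ : X →L[ℝ] X} {c₀ C : ℝ} {N : Set Y}
    (hh : ContDiffAt ℝ 1 h (q, 0)) (h0 : ∀ᶠ y in nhds q, h (y, 0) = 0)
    (hA : HasFDerivAt (fun x => h (q, x)) (-A₀) 0)
    (hPs : ∀ x y, inner ℝ (P x) y = inner ℝ x (P y)) (hP : ∀ x, ‖x‖ ^ 2 ≤ inner ℝ (P x) x)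
    (hc₀ : 0 < c₀) (hPA : ∀ x, c₀ * ‖x‖ ^ 2 ≤ inner ℝ (P x) (A₀ x))
    (hG : ContDiffAt ℝ 1 G q) (hC : 0 < C) (hGa : ∀ᶠ y in nhds q, ‖G y‖ ≤ C * ‖a y‖)
    (ha : ContDiffAt ℝ 1 a q) (haq : a q = 0) (hsurj : Filter.map a (nhds q) = nhds 0)
    (hah : ∀ᶠ y in nhds q, fderiv ℝ a y (G y) = h (y, a y)) (hN : N ∈ nhds q) :
    ∃ δ > 0, ∃ K > 0, ∃ r > 0, ∃ V ∈ nhds q,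
      (∀ x₀ : X, ‖x₀‖ < δ → ∃ p₀ ∈ V, a p₀ = x₀) ∧
      ∀ p₀ ∈ V,
        (∃ p : ℝ → Y, p 0 = p₀ ∧ ∀ t, 0 ≤ t → HasDerivWithinAt p (G (p t)) (Set.Ici 0) t) ∧
        ∀ p : ℝ → Y, p 0 = p₀ → (∀ t, 0 ≤ t → HasDerivWithinAt p (G (p t)) (Set.Ici 0) t) →
          (∀ t, 0 ≤ t → p t ∈ N ∧
            HasDerivWithinAt (fun s => a (p s)) (h (p t, a (p t))) (Set.Ici 0) t ∧
            ‖a (p t)‖ ≤ K * ‖a p₀‖ * Real.exp (-r * t)) ∧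
          IsExpStableAtOrigin (fun t x => h (p t, x)) δ K r := by
  set M : ℝ := max 1 ‖P‖ with hMdef
  have hM : 1 ≤ M := le_max_left _ _
  have hPM : ‖P‖ ≤ M := le_max_right _ _
  have hM0 : 0 < M := by linarith
  -- Half of the linear decay rate `c₀` is kept; the other half absorbs the nonlinear remainder,
  -- taken at most `c / M * ‖x‖`.
  set c : ℝ := c₀ / 2 with hcdef
  have hc : 0 < c := by positivity
  obtain ⟨h', Kh, Lh, hlip, hbd, heq⟩ := hh.exists_lipschitzWith_bounded_eventuallyEq
  obtain ⟨G', KG, LG, hGlip, hGbd, hGeq⟩ := hG.exists_lipschitzWith_bounded_eventuallyEq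
  obtain ⟨ε, hε, hball⟩ := Metric.eventually_nhds_iff_ball.1
    (heq.and (eventually_norm_add_le_of_contDiffAt hh h0 hA (η := c / M) (by positivity)))
  have hnear : ∀ y ∈ Metric.ball q ε, ∀ x : X, ‖x‖ < ε → h' (y, x) = h (y, x) ∧
      inner ℝ (P x) (h (y, x)) ≤ -c * ‖x‖ ^ 2 := by
    intro y hy x hx
    obtain ⟨h1, h2⟩ := hball (y, x) (by
      rw [← ball_prod_same]
      exact ⟨hy, by simpa using hx⟩)
    refine ⟨h1, ?_⟩
    have h3 : inner ℝ (P x) (h (y, x) + A₀ x) ≤ c * ‖x‖ ^ 2 := by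
      calc inner ℝ (P x) (h (y, x) + A₀ x) ≤ ‖P x‖ * ‖h (y, x) + A₀ x‖ := real_inner_le_norm _ _
        _ ≤ (M * ‖x‖) * (c / M * ‖x‖) := by
          gcongr
          exact (P.le_opNorm x).trans (by gcongr)
        _ = _ := by field_simp
    rw [inner_add_right] at h3
    have h4 := hPA x
    have : c₀ = 2 * c := by rw [hcdef]; ring
    rw [this] at h4
    linarith
  have hasmall : ∀ᶠ y in nhds q, ‖a y‖ < ε := by
    have : Filter.Tendsto (fun y => ‖a y‖) (nhds q) (nhds ‖a q‖) := ha.continuousAt.norm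
    rw [haq, norm_zero] at this
    exact this.eventually_lt_const hε
  have hadiff : ∀ᶠ y in nhds q, DifferentiableAt ℝ a y :=
    (ha.eventually (by simp)).mono fun y hy => hy.differentiableAt (by simp)
  obtain ⟨ρ', hρ', hball'⟩ := Metric.eventually_nhds_iff_ball.1
    (((hGeq.and hGa).and (h0.and hah)).and ((hasmall.and hadiff).and hN))
  set ρ := min ρ' ε with hρdef
  have hρ : 0 < ρ := lt_min hρ' hε
  have hρε : ∀ y ∈ Metric.ball q ρ, y ∈ Metric.ball q ε := fun y hy =>
    Metric.ball_subset_ball (min_le_right _ _) hy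
  replace hball' := fun y (hy : y ∈ Metric.ball q ρ) =>
    hball' y (Metric.ball_subset_ball (min_le_left _ _) hy)
  have hdec : ∀ y ∈ Metric.ball q ρ,
      inner ℝ (P (a y)) (fderiv ℝ a y (G y)) ≤ -c * ‖a y‖ ^ 2 := fun y hy => by
    obtain ⟨⟨-, -, h1⟩, ⟨h2, -⟩, -⟩ := hball' y hy
    rw [h1]
    exact (hnear y (hρε y hy) _ h2).2
  -- Initial points from which initial distance plus travel allowance stays below `ρ`.
  let V : Set Y := {y | dist y q + C * (M * ‖a y‖) / (c / M) < ρ}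
  have hV : V ∈ nhds q := by
    have h1 : ContinuousAt (fun y => dist y q + C * (M * ‖a y‖) / (c / M)) q := by
      have := ha.continuousAt
      fun_prop
    have h2 : Filter.Tendsto (fun y => dist y q + C * (M * ‖a y‖) / (c / M)) (nhds q) (nhds 0) := by
      have := h1.tendsto
      simpa [haq] using this
    exact h2.eventually_lt_const hρ
  have himg : a '' V ∈ nhds (0 : X) := hsurj ▸ Filter.image_mem_map hV
  obtain ⟨δ', hδ', himg'⟩ := Metric.mem_nhds_iff.1 himg
  have hstay : ∀ p : ℝ → Y, p 0 ∈ V → ContinuousOn p (Set.Ici 0) →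
      (∀ t, 0 ≤ t → p t ∈ Metric.ball q ρ → HasDerivWithinAt p (G (p t)) (Set.Ici 0) t) →
      ∀ t, 0 ≤ t → p t ∈ Metric.ball q ρ := fun p hp0 hpc hpd =>
    mem_ball_of_flow hPs hP hM hPM hc hC (fun y hy => (hball' y hy).2.1.2) hdec
      (fun y hy => (hball' y hy).1.1.2) hpc hpd hp0
  -- `δ'` keeps the initial errors within `a '' V`; `ε / M` keeps solutions of gain `M` below `ε`.
  refine ⟨min δ' (ε / M), by positivity, M, hM0, c / M, by positivity, V, hV, ?_, ?_⟩
  · intro x₀ hx₀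
    obtain ⟨p₀, hp₀, rfl⟩ := himg' (mem_ball_zero_iff.2 (hx₀.trans_le (min_le_left _ _)))
    exact ⟨p₀, hp₀, rfl⟩
  intro p₀ hp₀
  constructor
  -- Solve for the truncated field; the solution never leaves the ball where it equals `G`.
  · obtain ⟨p, hp0, hp⟩ := exists_forall_hasDerivWithinAt_of_lipschitz_of_bounded (t₀ := 0)
      (g := fun _ => G') (fun _ _ => hGlip) (fun _ _ => hGbd) (fun _ => continuousOn_const) p₀
    have hin := hstay p (hp0 ▸ hp₀) (fun t ht => (hp t ht).continuousWithinAt) fun t ht hpt => by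
      rw [← (hball' _ hpt).1.1.1]
      exact hp t ht
    refine ⟨p, hp0, fun t ht => ?_⟩
    rw [← (hball' _ (hin t ht)).1.1.1]
    exact hp t ht
  · rintro p rfl hp
    have hpc : ContinuousOn p (Set.Ici 0) := fun t ht => (hp t ht).continuousWithinAt
    have hin := hstay p hp₀ hpc fun t ht _ => hp t ht
    have hap : ∀ t, 0 ≤ t →
        HasDerivWithinAt (fun s => a (p s)) (h (p t, a (p t))) (Set.Ici 0) t := fun t ht => by
      obtain ⟨⟨-, -, h1⟩, ⟨-, h2⟩, -⟩ := hball' _ (hin t ht)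
      rw [← h1]
      exact h2.hasFDerivAt.comp_hasDerivWithinAt t (hp t ht)
    refine ⟨fun t ht => ⟨(hball' _ (hin t ht)).2.2, hap t ht, ?_⟩,
      fun t ht => (hball' _ (hin t ht)).1.2.1, fun t₀ ht₀ x₀ hx₀ => ?_⟩
    · have := norm_le_exp_of_quadratic_deriv_le (x := fun s => a (p s)) hPs hP hM hPM hc ht
        (fun s hs => (hap s hs.1).continuousWithinAt.mono Set.Icc_subset_Ici_self)
        fun s hs => ⟨_, hap s hs.1,
          (hnear _ (hρε _ (hin s hs.1)) _ (hball' _ (hin s hs.1)).2.1.1).2⟩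
      rwa [sub_zero] at this
    · have hMx : M * ‖x₀‖ < ε := by
        have := hx₀.trans_le (min_le_right _ _)
        rwa [lt_div_iff₀ hM0, mul_comm] at this
      have hest : ∀ (T : ℝ) (x : ℝ → X), x t₀ = x₀ → ContinuousOn x (Set.Ico t₀ T) →
          (∀ t ∈ Set.Ico t₀ T, ‖x t‖ < ε → HasDerivWithinAt x (h (p t, x t)) (Set.Ici t₀) t) →
          ∀ t ∈ Set.Ico t₀ T, ‖x t‖ < ε ∧
            ‖x t‖ ≤ M * ‖x₀‖ * Real.exp (-(c / M) * (t - t₀)) := by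
        rintro T x rfl hxc hx
        exact norm_lt_and_le_exp_of_quadratic_deriv_le hPs hP hM hPM hc hxc hMx
          fun s hs hs' => ⟨_, hx s hs hs',
            (hnear _ (hρε _ (hin s (ht₀.trans hs.1))) _ hs').2⟩
      constructor
      · have hpt₀ : ContinuousOn p (Set.Ici t₀) := hpc.mono (Set.Ici_subset_Ici.2 ht₀)
        obtain ⟨x, hx0, hx⟩ := exists_forall_hasDerivWithinAt_of_lipschitz_of_bounded (t₀ := t₀)
          (g := fun t x => h' (p t, x)) (K := Kh * 1) (L := Lh)
          (fun t _ => hlip.comp (LipschitzWith.prodMk_left (p t)))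
          (fun _ _ _ => hbd _)
          (fun x => hlip.continuous.comp_continuousOn (hpt₀.prodMk continuousOn_const)) x₀
        have hmem := fun t (ht : 0 ≤ t) => hρε _ (hin t ht)
        refine ⟨x, hx0, fun t ht => ?_⟩
        -- The estimate lives on half-open intervals, so `t + 1` is taken to include `t`. It keeps
        -- `x` where `h'` and `h` coincide.
        have hlt := (hest (t + 1) x hx0
          (fun s hs => (hx s hs.1).continuousWithinAt.mono Set.Ico_subset_Ici_self)
          (fun s hs hs' => by
            rw [← (hnear _ (hmem s (ht₀.trans hs.1)) _ hs').1]
            exact hx s hs.1) t ⟨ht, by linarith⟩).1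
        beta_reduce
        rw [← (hnear _ (hmem t (ht₀.trans ht)) _ hlt).1]
        exact hx t ht
      · exact fun T x hx0 hx t ht => (hest T x hx0
          (fun s hs => (hx s hs).continuousWithinAt.mono Set.Ico_subset_Ici_self)
          (fun s hs _ => hx s hs) t ht).2

/-! ### Submersions: functional dependence and gradient flow -/

/-- If `a` is a submersion at `q` and the derivative of `b` vanishes on the kernel of the derivative
of `a` near `q`, then `b` is locally a smooth function of `a`. -/
theorem exists_contDiffAt_eventually_eq_comp_of_ker_le {X Y Z : Type*} [NormedAddCommGroup X]
    [NormedSpace ℝ X] [CompleteSpace X] [NormedAddCommGroup Y] [InnerProductSpace ℝ Y]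
    [CompleteSpace Y] [NormedAddCommGroup Z] [NormedSpace ℝ Z] {n : WithTop ℕ∞} (hn : 1 ≤ n)
    {q : Y} {a : Y → X} {b : Y → Z} (ha : ContDiffAt ℝ n a q) (hb : ContDiffAt ℝ n b q)
    (hsurj : Function.Surjective (fderiv ℝ a q))
    (hker : ∀ᶠ y in nhds q, ∀ v, fderiv ℝ a y v = 0 → fderiv ℝ b y v = 0) :
    ∃ f : X → Z, ContDiffAt ℝ n f (a q) ∧ ∀ᶠ y in nhds q, b y = f (a y) := by
  have hn0 : n ≠ 0 := by
    rintro rfl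
    simp at hn
  let R := fderiv ℝ a q
  let κ : Submodule ℝ Y := R.ker
  have : CompleteSpace κ := (ContinuousLinearMap.isClosed_ker R).completeSpace_coe
  let π : Y →L[ℝ] κ := κ.orthogonalProjectionOnto
  have hπ : π.range = ⊤ := LinearMap.range_eq_top.2 fun v =>
    ⟨v, κ.orthogonalProjectionOnto_mem_subspace_eq_self v⟩
  have hcompl : IsCompl R.ker π.ker := by
    rw [Submodule.ker_orthogonalProjectionOnto]
    exact Submodule.isCompl_orthogonal κ
  have hR : R.range = ⊤ := LinearMap.range_eq_top.2 hsurj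
  let Φ : Y ≃L[ℝ] X × κ := R.equivProdOfSurjectiveOfIsCompl π hR hπ hcompl
  -- Local coordinates at `q`: the value of `a`, and the position along its fibre given by the
  -- projection to `ker R`.
  let φ : Y → X × κ := fun y => (a y, π y)
  have hφ : ContDiffAt ℝ n φ q := ha.prodMk π.contDiff.contDiffAt
  have hφ' : HasFDerivAt φ (Φ : Y →L[ℝ] X × κ) q :=
    (ha.differentiableAt hn0).hasFDerivAt.prodMk π.hasFDerivAt
  let e := hφ.toOpenPartialHomeomorph φ hφ' hn0
  let ψ : X × κ → Y := e.symm
  have hes : q ∈ e.source := hφ.mem_toOpenPartialHomeomorph_source hφ' hn0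
  have het : φ q ∈ e.target := hφ.image_mem_toOpenPartialHomeomorph_target hφ' hn0
  have hψq : ψ (φ q) = q := e.left_inv hes
  have hψ : ContDiffAt ℝ n ψ (φ q) := hφ.to_localInverse hφ' hn0
  have hψt : Filter.Tendsto ψ (nhds (φ q)) (nhds q) := by
    have := hψ.continuousAt.tendsto
    rwa [hψq] at this
  have hψd : ∀ᶠ z in nhds (φ q), DifferentiableAt ℝ ψ z :=
    ((hψ.of_le hn).eventually (by simp)).mono fun y hy => hy.differentiableAt (by simp)
  obtain ⟨ε, hε, hball⟩ := Metric.eventually_nhds_iff_ball.1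
    ((hψd.and (e.open_target.mem_nhds het)).and
      (hψt.eventually ((((ha.of_le hn).eventually (by simp)).and
        ((hb.of_le hn).eventually (by simp))).and hker)))
  -- With the first coordinate fixed, `a` is constant, so `hker` kills the derivative of `b` along
  -- the fibre. Balls of the product are products of balls, so each slice is convex.
  have hconst : ∀ z ∈ Metric.ball (φ q) ε, b (ψ z) = b (ψ (z.1, π q)) := by
    intro z hz
    rw [← ball_prod_same] at hz
    have hin : ∀ k ∈ Metric.ball (π q) ε, (z.1, k) ∈ Metric.ball (φ q) ε := fun k hk => by
      rw [← ball_prod_same]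
      exact ⟨hz.1, hk⟩
    have hd : ∀ k ∈ Metric.ball (π q) ε, HasFDerivAt (fun k => b (ψ (z.1, k))) (0 : κ →L[ℝ] Z) k := by
      intro k hk
      obtain ⟨⟨h1, -⟩, ⟨h3, h4⟩, h5⟩ := hball _ (hin k hk)
      have h6 : HasFDerivAt (fun k => ψ (z.1, k))
          ((fderiv ℝ ψ (z.1, k)).comp (ContinuousLinearMap.inr ℝ X κ)) k :=
        HasFDerivAt.comp (g := ψ) k h1.hasFDerivAt (hasFDerivAt_prodMk_right z.1 k)
      have h7 := HasFDerivAt.comp (g := b) k (h4.differentiableAt (by simp)).hasFDerivAt h6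
      have h8 := HasFDerivAt.comp (g := a) k (h3.differentiableAt (by simp)).hasFDerivAt h6
      have h9 : HasFDerivAt (a ∘ fun k => ψ (z.1, k)) (0 : κ →L[ℝ] X) k := by
        refine (hasFDerivAt_const z.1 k).congr_of_eventuallyEq ?_
        filter_upwards [Metric.isOpen_ball.mem_nhds hk] with k' hk'
        exact congrArg Prod.fst (e.right_inv (hball _ (hin k' hk')).1.2)
      refine h7.congr_fderiv ?_
      ext v
      exact h5 _ (congrArg (fun T => T v) (h8.unique h9))
    refine (convex_ball (π q) ε).is_const_of_fderivWithin_eq_zero (𝕜 := ℝ)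
      (f := fun k => b (ψ (z.1, k)))
      (fun k hk => (hd k hk).differentiableAt.differentiableWithinAt) (fun k hk => ?_) hz.2
      (Metric.mem_ball_self hε)
    rw [fderivWithin_of_isOpen Metric.isOpen_ball hk, (hd k hk).fderiv]
  refine ⟨fun x => b (ψ (x, π q)), ?_, ?_⟩
  · have h1 : ContDiffAt ℝ n (fun x : X => (x, π q)) (a q) := contDiffAt_id.prodMk contDiffAt_const
    have h2 : ContDiffAt ℝ n b (ψ (φ q)) := by rwa [hψq]
    exact ContDiffAt.comp (g := fun z => b (ψ z)) (a q) (h2.comp (φ q) hψ) h1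
  · filter_upwards [e.open_source.mem_nhds hes,
      hφ.continuousAt.eventually (Metric.ball_mem_nhds _ hε)] with y hy hy'
    have h1 := hconst _ hy'
    have h2 : ψ (φ y) = y := e.left_inv hy
    rwa [h2] at h1

/-- Over `ℝ` the adjoint is linear and norm-preserving. This passes regularity of the rigidity
matrix to its transpose. -/
theorem contDiff_adjoint {X Y : Type*} [NormedAddCommGroup X] [InnerProductSpace ℝ X]
    [CompleteSpace X] [NormedAddCommGroup Y] [InnerProductSpace ℝ Y] [CompleteSpace Y]
    {n : WithTop ℕ∞} :
    ContDiff ℝ n (fun T : X →L[ℝ] Y => ContinuousLinearMap.adjoint T) := by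
  refine IsBoundedLinearMap.contDiff ⟨⟨fun S T => map_add _ S T, fun c T => ?_⟩, 1, one_pos, ?_⟩
  · simp
  · intro T
    simp

/-- If `R` is surjective, `x ↦ R (Rᵀ x + (D R)ᵀ D x)` is positive definite for the quadratic form
of `1 + Dᵀ D`. -/
theorem exists_pos_le_inner_of_surjective {X Y Z : Type*} [NormedAddCommGroup X]
    [InnerProductSpace ℝ X] [FiniteDimensional ℝ X] [CompleteSpace X] [NormedAddCommGroup Y]
    [InnerProductSpace ℝ Y] [CompleteSpace Y] [NormedAddCommGroup Z] [InnerProductSpace ℝ Z]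
    [CompleteSpace Z] {R : Y →L[ℝ] X} (hR : Function.Surjective R) (D : X →L[ℝ] Z) :
    ∃ P : X →L[ℝ] X, (∀ x y, inner ℝ (P x) y = inner ℝ x (P y)) ∧
      (∀ x, ‖x‖ ^ 2 ≤ inner ℝ (P x) x) ∧ ∃ c > 0, ∀ x, c * ‖x‖ ^ 2 ≤ inner ℝ (P x)
        (R (ContinuousLinearMap.adjoint R x + ContinuousLinearMap.adjoint (D.comp R) (D x))) := by
  -- Chosen so that `Rᵀ x + (D R)ᵀ D x = Rᵀ P x`; pairing `R` of this with `P x` gives `‖Rᵀ P x‖²`.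
  let P : X →L[ℝ] X := .id ℝ X + (ContinuousLinearMap.adjoint D).comp D
  have hPx : ∀ x y, inner ℝ (P x) y = inner ℝ x y + inner ℝ (D x) (D y) := fun x y => by
    simp [P, inner_add_left, ContinuousLinearMap.adjoint_inner_left]
  have hP : ∀ x, ‖x‖ ^ 2 ≤ inner ℝ (P x) x := fun x => by
    rw [hPx, real_inner_self_eq_norm_sq, real_inner_self_eq_norm_sq]
    linarith [sq_nonneg ‖D x‖]
  refine ⟨P, fun x y => ?_, hP, ?_⟩
  · rw [hPx, real_inner_comm (P y) x, hPx, real_inner_comm x, real_inner_comm (D x)]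
  let T : X →L[ℝ] Y := (ContinuousLinearMap.adjoint R).comp P
  have hT : LinearMap.ker (T : X →ₗ[ℝ] Y) = ⊥ := by
    rw [LinearMap.ker_eq_bot']
    intro x hx
    obtain ⟨u, hu⟩ := hR (P x)
    have h1 : inner ℝ (R u) (P x) = 0 := by
      rw [← ContinuousLinearMap.adjoint_inner_right, show ContinuousLinearMap.adjoint R (P x) = 0
        from hx, inner_zero_right]
    rw [hu, inner_self_eq_zero] at h1
    have h2 := hP x
    rw [h1, inner_zero_left] at h2
    have : ‖x‖ = 0 := by nlinarith [norm_nonneg x]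
    exact norm_eq_zero.1 this
  -- Finite dimension turns injectivity of `Rᵀ P` into a quantitative lower bound.
  obtain ⟨K, hK, hKT⟩ := (T : X →ₗ[ℝ] Y).exists_antilipschitzWith hT
  have hK' : (0 : ℝ) < K := hK
  have hb : ∀ x, ‖x‖ ≤ K * ‖T x‖ := fun x => by
    simpa using hKT.le_mul_dist x 0
  refine ⟨1 / K ^ 2, by positivity, fun x => ?_⟩
  have h1 : ContinuousLinearMap.adjoint R x + ContinuousLinearMap.adjoint (D.comp R) (D x) = T x := by
    simp [T, P, ContinuousLinearMap.adjoint_comp]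
  rw [h1, ← ContinuousLinearMap.adjoint_inner_left]
  change _ ≤ inner ℝ (T x) (T x)
  rw [real_inner_self_eq_norm_sq, one_div, inv_mul_le_iff₀ (by positivity), ← mul_pow]
  exact pow_le_pow_left₀ (norm_nonneg _) (hb x) 2

/-- The gradient flow of `½ ‖a‖² + ½ ‖b‖²` where `a` is a submersion at its zero `q` and `b` is a
function of `a`. -/
theorem exists_expStable_of_submersion {X Y Z : Type*} [NormedAddCommGroup X]
    [InnerProductSpace ℝ X] [FiniteDimensional ℝ X] [CompleteSpace X] [NormedAddCommGroup Y]
    [InnerProductSpace ℝ Y] [FiniteDimensional ℝ Y] [CompleteSpace Y] [NormedAddCommGroup Z]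
    [InnerProductSpace ℝ Z] [CompleteSpace Z] {q : Y} {a : Y → X} {b : Y → Z} {f : X → Z}
    {G : Y → Y} {N : Set Y} (ha : ContDiffAt ℝ 2 a q) (hb : ContDiffAt ℝ 2 b q)
    (hf : ContDiffAt ℝ 1 f 0) (haq : a q = 0) (hf0 : f 0 = 0)
    (hsurj : Function.Surjective (fderiv ℝ a q)) (hbf : ∀ᶠ y in nhds q, b y = f (a y))
    (hG : ∀ᶠ y in nhds q, G y = -(ContinuousLinearMap.adjoint (fderiv ℝ a y) (a y) +
      ContinuousLinearMap.adjoint (fderiv ℝ b y) (b y))) (hN : N ∈ nhds q) :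
    let h : Y → X → X := fun y x =>
      -fderiv ℝ a y (ContinuousLinearMap.adjoint (fderiv ℝ a y) x) -
        fderiv ℝ a y (ContinuousLinearMap.adjoint (fderiv ℝ b y) (f x))
    ∃ δ > 0, ∃ K > 0, ∃ r > 0, ∃ V ∈ nhds q,
      (∀ x₀ : X, ‖x₀‖ < δ → ∃ p₀ ∈ V, a p₀ = x₀) ∧
      ∀ p₀ ∈ V,
        (∃ p : ℝ → Y, p 0 = p₀ ∧ ∀ t, 0 ≤ t → HasDerivWithinAt p (G (p t)) (Set.Ici 0) t) ∧
        ∀ p : ℝ → Y, p 0 = p₀ → (∀ t, 0 ≤ t → HasDerivWithinAt p (G (p t)) (Set.Ici 0) t) →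
          (∀ t, 0 ≤ t → p t ∈ N ∧
            HasDerivWithinAt (fun s => a (p s)) (h (p t) (a (p t))) (Set.Ici 0) t ∧
            ‖a (p t)‖ ≤ K * ‖a p₀‖ * Real.exp (-r * t)) ∧
          IsExpStableAtOrigin (fun t x => h (p t) x) δ K r := by
  intro h
  have hstrict : HasStrictFDerivAt a (fderiv ℝ a q) q := ha.hasStrictFDerivAt (by simp)
  have hf' : HasFDerivAt f (fderiv ℝ f 0) 0 := (hf.differentiableAt (by simp)).hasFDerivAt
  have hS : fderiv ℝ b q = (fderiv ℝ f 0).comp (fderiv ℝ a q) := by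
    have h1 : HasFDerivAt (fun y => f (a y)) ((fderiv ℝ f 0).comp (fderiv ℝ a q)) q :=
      HasFDerivAt.comp (g := f) q (by rwa [haq]) hstrict.hasFDerivAt
    exact (h1.congr_of_eventuallyEq hbf).fderiv
  obtain ⟨P, hPs, hP, c, hc, hPc⟩ := exists_pos_le_inner_of_surjective hsurj (fderiv ℝ f 0)
  have hR1 : ContDiffAt ℝ 1 (fderiv ℝ a) q := ha.fderiv_right (by norm_num)
  have hS1 : ContDiffAt ℝ 1 (fderiv ℝ b) q := hb.fderiv_right (by norm_num)
  have hRt : ContDiffAt ℝ 1 (fun y => ContinuousLinearMap.adjoint (fderiv ℝ a y)) q :=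
    contDiff_adjoint.contDiffAt.comp q hR1
  have hSt : ContDiffAt ℝ 1 (fun y => ContinuousLinearMap.adjoint (fderiv ℝ b y)) q :=
    contDiff_adjoint.contDiffAt.comp q hS1
  -- Minus the derivative of `h q` at `0`; by `hS` it is the operator treated in `hPc`.
  let A₀ : X →L[ℝ] X := (fderiv ℝ a q).comp (ContinuousLinearMap.adjoint (fderiv ℝ a q) +
    (ContinuousLinearMap.adjoint (fderiv ℝ b q)).comp (fderiv ℝ f 0))
  obtain ⟨C₁, hC₁, hfb⟩ := hf'.isBigO_sub.exists_pos
  obtain ⟨CR, hCR⟩ := hRt.continuousAt.norm.isBoundedUnder_le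
  obtain ⟨CS, hCS⟩ := hSt.continuousAt.norm.isBoundedUnder_le
  have hat : Filter.Tendsto a (nhds q) (nhds 0) := haq ▸ ha.continuousAt.tendsto
  -- `C` bounds `‖G‖ / ‖a‖` through local bounds on the two adjoints and `‖f x‖ ≤ C₁ * ‖x‖`; the
  -- summand `1` only ensures positivity.
  refine exists_expStable_of_lyapunov (h := fun z => h z.1 z.2) (P := P) (A₀ := A₀) (c₀ := c)
    (C := |CR| + |CS| * C₁ + 1) ?_ ?_ ?_ hPs hP hc ?_ ?_ (by positivity) ?_ (ha.of_le (by norm_num)) haq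
    ?_ ?_ hN
  · have hfst : ContDiffAt ℝ 1 (Prod.fst : Y × X → Y) (q, 0) := contDiffAt_fst
    have e1 : ContDiffAt ℝ 1 (fun z : Y × X => fderiv ℝ a z.1) (q, 0) :=
      ContDiffAt.comp (g := fderiv ℝ a) (q, (0 : X)) hR1 hfst
    have e2 : ContDiffAt ℝ 1
        (fun z : Y × X => ContinuousLinearMap.adjoint (fderiv ℝ a z.1)) (q, 0) :=
      contDiff_adjoint.contDiffAt.comp _ e1
    have e3 : ContDiffAt ℝ 1
        (fun z : Y × X => ContinuousLinearMap.adjoint (fderiv ℝ b z.1)) (q, 0) :=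
      contDiff_adjoint.contDiffAt.comp _
        (ContDiffAt.comp (g := fderiv ℝ b) (q, (0 : X)) hS1 hfst)
    have e4 : ContDiffAt ℝ 1 (fun z : Y × X => f z.2) (q, 0) :=
      ContDiffAt.comp (g := f) (q, (0 : X)) hf contDiffAt_snd
    exact ((e1.clm_apply (e2.clm_apply contDiffAt_snd)).neg).sub (e1.clm_apply (e3.clm_apply e4))
  · exact Filter.Eventually.of_forall fun y => by simp [h, hf0]
  · have e1 := (-((fderiv ℝ a q).comp (ContinuousLinearMap.adjoint
        (fderiv ℝ a q)))).hasFDerivAt (x := (0 : X))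
    have e2 := (((fderiv ℝ a q).comp (ContinuousLinearMap.adjoint
        (fderiv ℝ b q))).hasFDerivAt).comp (0 : X) hf'
    refine (e1.sub e2).congr_fderiv ?_
    ext1 x
    simp [A₀]
    abel
  · intro x
    have := hPc x
    simpa [A₀, hS] using this
  · refine ContDiffAt.congr_of_eventuallyEq ?_ hG
    exact ((hRt.clm_apply (ha.of_le (by norm_num))).add
      (hSt.clm_apply (hb.of_le (by norm_num)))).neg
  · filter_upwards [hG, hbf, hCR, hCS, hat.eventually hfb.bound] with y h1 h2 h3 h4 h5
    rw [h1, norm_neg, h2]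
    rw [hf0, sub_zero, sub_zero] at h5
    have h3' := h3.trans (le_abs_self CR)
    have h4' := h4.trans (le_abs_self CS)
    have i1 := ContinuousLinearMap.le_of_opNorm_le _ h3' (a y)
    have i2 : ‖ContinuousLinearMap.adjoint (fderiv ℝ b y) (f (a y))‖ ≤ |CS| * (C₁ * ‖a y‖) :=
      (ContinuousLinearMap.le_of_opNorm_le _ h4' _).trans (by gcongr)
    refine (norm_add_le _ _).trans ?_
    linarith [norm_nonneg (a y)]
  · rw [hstrict.map_nhds_eq_of_surj (LinearMap.range_eq_top.2 hsurj), haq]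
  · filter_upwards [hG, hbf] with y h1 h2
    rw [h1, h2, map_neg, map_add]
    simp only [h]
    abel

/-! ### Kernels of nearby operators -/

/-- If every kernel vector of a surjective `R q` extends to a continuous local section of the
kernels of `R` and `S`, then `ker (R p) ≤ ker (S p)` near `q`. -/
theorem eventually_ker_le_of_continuousAt_sections {T X Y Z : Type*} [TopologicalSpace T]
    [NormedAddCommGroup X] [NormedSpace ℝ X] [FiniteDimensional ℝ X] [NormedAddCommGroup Y]
    [NormedSpace ℝ Y] [FiniteDimensional ℝ Y] [NormedAddCommGroup Z] [NormedSpace ℝ Z] {q : T}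
    {R : T → Y →L[ℝ] X} {S : T → Y →L[ℝ] Z} (hR : ContinuousAt R q)
    (hsurj : Function.Surjective (R q))
    (hsec : ∀ w, R q w = 0 → ∃ u : T → Y, ContinuousAt u q ∧ u q = w ∧
      ∀ᶠ p in nhds q, R p (u p) = 0 ∧ S p (u p) = 0) :
    ∀ᶠ p in nhds q, ∀ v, R p v = 0 → S p v = 0 := by
  let κ : Submodule ℝ Y := LinearMap.ker (R q : Y →ₗ[ℝ] X)
  let β := Module.finBasis ℝ κ
  choose u hu huq huk using fun i => hsec (β i) (β i).2
  have hcont : ContinuousAt (fun p i => u i p) q := continuousAt_pi.2 hu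
  have hli : LinearIndependent ℝ (fun i => u i q) := by
    have h1 := β.linearIndependent.map' κ.subtype κ.ker_subtype
    have h2 : (fun i => u i q) = κ.subtype ∘ β := funext huq
    rwa [h2]
  have hli' : ∀ᶠ p in nhds q, LinearIndependent ℝ (fun i => u i p) :=
    hcont.eventually hli.eventually
  have hrank : ∀ᶠ p in nhds q, (Module.finrank ℝ X : Cardinal) ≤ (R p : Y →ₗ[ℝ] X).rank := by
    refine hR.eventually ((isOpen_setOfPred_nat_le_rank _).mem_nhds ?_)
    change (Module.finrank ℝ X : Cardinal) ≤ (R q : Y →ₗ[ℝ] X).rank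
    rw [LinearMap.rank, LinearMap.range_eq_top.2 hsurj, rank_top, Module.finrank_eq_rank]
  filter_upwards [hli', hrank, Filter.eventually_all.2 huk] with p h1 h2 h3 v hv
  have hle : Submodule.span ℝ (Set.range fun i => u i p) ≤ LinearMap.ker (R p : Y →ₗ[ℝ] X) :=
    Submodule.span_le.2 (by rintro _ ⟨i, rfl⟩; exact (h3 i).1)
  -- The rank of `R p` cannot drop below `finrank ℝ X`, so its kernel is no larger than that of `R
  -- q`; the independent sections therefore exhaust it.
  have hfin : Module.finrank ℝ (LinearMap.ker (R p : Y →ₗ[ℝ] X)) ≤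
      Module.finrank ℝ (Submodule.span ℝ (Set.range fun i => u i p)) := by
    rw [finrank_span_eq_card h1, Fintype.card_fin]
    have e1 := LinearMap.finrank_range_add_finrank_ker (R p : Y →ₗ[ℝ] X)
    have e2 := LinearMap.finrank_range_add_finrank_ker (R q : Y →ₗ[ℝ] X)
    rw [LinearMap.range_eq_top.2 hsurj, finrank_top] at e2
    have e3 : Module.finrank ℝ X ≤ Module.finrank ℝ (LinearMap.range (R p : Y →ₗ[ℝ] X)) := by
      rw [LinearMap.rank, ← Module.finrank_eq_rank] at h2
      exact_mod_cast h2
    change _ ≤ Module.finrank ℝ (LinearMap.ker (R q : Y →ₗ[ℝ] X))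
    omega
  have heq := Submodule.eq_of_le_of_finrank_le hle hfin
  have hv' : v ∈ Submodule.span ℝ (Set.range fun i => u i p) := heq ▸ hv
  have hle' : Submodule.span ℝ (Set.range fun i => u i p) ≤ LinearMap.ker (S p : Y →ₗ[ℝ] Z) :=
    Submodule.span_le.2 (by rintro _ ⟨i, rfl⟩; exact (h3 i).2)
  exact hle' hv'

/-! ### Constraint functions, their derivatives and trivial motions -/

section Framework

variable {n d : ℕ} {E E' : Finset (Sym2 (Fin n))} {A A' : Finset (Fin n × Fin n × Fin n)}
  {p q v : Config n d}

theorem contDiff_pos {m : WithTop ℕ∞} (i : Fin n) :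
    ContDiff ℝ m (fun p : Config n d => pos p i) :=
  contDiff_euclidean.2 fun c =>
    (EuclideanSpace.proj (i, c) : Config n d →L[ℝ] ℝ).contDiff

theorem pos_add_smul (p v : Config n d) (t : ℝ) (i : Fin n) :
    pos (p + t • v) i = pos p i + t • pos v i := by
  ext c
  simp [pos]

theorem hasDerivAt_pos_sub (p v : Config n d) (i j : Fin n) :
    HasDerivAt (fun t : ℝ => pos (p + t • v) i - pos (p + t • v) j) (pos v i - pos v j) 0 := by
  have h : (fun t : ℝ => pos (p + t • v) i - pos (p + t • v) j) =
      fun t => (pos p i - pos p j) + t • (pos v i - pos v j) := by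
    funext t
    simp only [pos_add_smul, smul_sub]
    abel
  rw [h]
  simpa using ((hasDerivAt_id (0 : ℝ)).smul_const (pos v i - pos v j)).const_add (pos p i - pos p j)

theorem contDiff_sqLength {m : WithTop ℕ∞} (e : Sym2 (Fin n)) :
    ContDiff ℝ m (fun p : Config n d => sqLength p e) := by
  induction e using Sym2.ind with
  | _ i j => exact ((contDiff_pos i).sub (contDiff_pos j)).norm_sq ℝ

theorem cosAngle_eq (p : Config n d) (a : Fin n × Fin n × Fin n) :
    cosAngle p a = inner ℝ (pos p a.2.1 - pos p a.1) (pos p a.2.2 - pos p a.1) /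
      (‖pos p a.2.1 - pos p a.1‖ * ‖pos p a.2.2 - pos p a.1‖) := by
  rw [cosAngle, EuclideanGeometry.angle, InnerProductGeometry.cos_angle]
  rfl

theorem contDiffAt_cosAngle {m : WithTop ℕ∞} {a : Fin n × Fin n × Fin n}
    (h₁ : pos p a.1 ≠ pos p a.2.1) (h₂ : pos p a.1 ≠ pos p a.2.2) :
    ContDiffAt ℝ m (fun p : Config n d => cosAngle p a) p := by
  simp only [cosAngle_eq]
  have d₁ : ContDiffAt ℝ m (fun p : Config n d => pos p a.2.1 - pos p a.1) p :=
    ((contDiff_pos _).sub (contDiff_pos _)).contDiffAt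
  have d₂ : ContDiffAt ℝ m (fun p : Config n d => pos p a.2.2 - pos p a.1) p :=
    ((contDiff_pos _).sub (contDiff_pos _)).contDiffAt
  have n₁ := sub_ne_zero.2 h₁.symm
  have n₂ := sub_ne_zero.2 h₂.symm
  exact (d₁.inner ℝ d₂).div ((d₁.norm ℝ n₁).mul (d₂.norm ℝ n₂))
    (mul_ne_zero (norm_ne_zero_iff.2 n₁) (norm_ne_zero_iff.2 n₂))

theorem angleDomain_anti (h : A' ⊆ A) : angleDomain d A ⊆ angleDomain d A' :=
  fun _ hp a ha => hp a (h ha)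

theorem isOpen_angleDomain (A : Finset (Fin n × Fin n × Fin n)) : IsOpen (angleDomain d A) := by
  have h : angleDomain d A = ⋂ a ∈ A, {p : Config n d | pos p a.1 ≠ pos p a.2.1} ∩
      {p | pos p a.1 ≠ pos p a.2.2} := by
    ext p
    simp [angleDomain]
  have hc : ∀ i, Continuous (fun p : Config n d => pos p i) := fun i =>
    (contDiff_pos (m := 0) i).continuous
  rw [h]
  exact isOpen_biInter_finset fun a _ =>
    (isOpen_ne_fun (hc _) (hc _)).inter (isOpen_ne_fun (hc _) (hc _))

theorem contDiffAt_weakRigidityFun {m : WithTop ℕ∞} (hp : p ∈ angleDomain d A) :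
    ContDiffAt ℝ m (weakRigidityFun E A) p := by
  refine contDiffAt_euclidean.2 fun c => ?_
  rcases c with e | a
  · exact (contDiff_sqLength e.1).contDiffAt
  · exact contDiffAt_cosAngle (hp a a.2).1 (hp a a.2).2

theorem weakRigidityMatrix_apply (hp : p ∈ angleDomain d A) (v : Config n d) (c : E ⊕ A) :
    weakRigidityMatrix E A p v c = fderiv ℝ (fun x => weakRigidityFun E A x c) p v := by
  have h1 : HasFDerivAt (weakRigidityFun E A) (weakRigidityMatrix E A p) p :=
    ((contDiffAt_weakRigidityFun (m := 1) hp).differentiableAt (by simp)).hasFDerivAt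
  have h2 := (EuclideanSpace.proj c : ErrorSpace E A →L[ℝ] ℝ).hasFDerivAt.comp p h1
  have h3 : HasFDerivAt (fun x => weakRigidityFun E A x c) _ p := h2
  rw [h3.fderiv]
  rfl

theorem weakRigidityMatrix_eq_zero_iff (hp : p ∈ angleDomain d A) :
    weakRigidityMatrix E A p v = 0 ↔ (∀ e ∈ E, fderiv ℝ (fun x => sqLength x e) p v = 0) ∧
      ∀ a ∈ A, fderiv ℝ (fun x => cosAngle x a) p v = 0 := by
  constructor
  · intro h
    have h' : ∀ c, fderiv ℝ (fun x => weakRigidityFun E A x c) p v = 0 := fun c => by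
      rw [← weakRigidityMatrix_apply hp, h]
      rfl
    exact ⟨fun e he => h' (Sum.inl ⟨e, he⟩), fun a ha => h' (Sum.inr ⟨a, ha⟩)⟩
  · rintro ⟨h1, h2⟩
    ext c
    rw [weakRigidityMatrix_apply hp]
    rcases c with e | a
    · exact h1 e e.2
    · exact h2 a a.2

theorem fderiv_sqLength_mk (p v : Config n d) (i j : Fin n) :
    fderiv ℝ (fun x : Config n d => sqLength x s(i, j)) p v =
      2 * inner ℝ (pos p i - pos p j) (pos v i - pos v j) := by
  have h1 := (contDiff_sqLength (n := n) (d := d) (m := 1) s(i, j)).differentiable (by simp) p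
  have h2 := h1.hasFDerivAt.hasLineDerivAt v
  have h3 := (hasDerivAt_pos_sub p v i j).norm_sq
  rw [zero_smul, add_zero] at h3
  exact HasDerivAt.unique h2 h3

/-- Infinitesimal rotations preserve inner products to first order. -/
theorem inner_mulVec_add_of_skew {J : Matrix (Fin d) (Fin d) ℝ} (hJ : J.transpose = -J)
    (u w : EuclideanSpace ℝ (Fin d)) :
    inner ℝ u (WithLp.toLp 2 (J.mulVec w)) + inner ℝ (WithLp.toLp 2 (J.mulVec u)) w = 0 := by
  have h : ∀ x y : EuclideanSpace ℝ (Fin d),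
      inner ℝ x (WithLp.toLp 2 (J.mulVec y)) = dotProduct x.ofLp (J.mulVec y.ofLp) := by
    intro x y
    rw [EuclideanSpace.inner_eq_star_dotProduct, dotProduct_comm]
    simp
  rw [real_inner_comm w, h, h, Matrix.dotProduct_mulVec, ← Matrix.mulVec_transpose, hJ,
    Matrix.neg_mulVec, neg_dotProduct, dotProduct_comm]
  ring

theorem inner_mulVec_self_of_skew {J : Matrix (Fin d) (Fin d) ℝ} (hJ : J.transpose = -J)
    (u : EuclideanSpace ℝ (Fin d)) : inner ℝ u (WithLp.toLp 2 (J.mulVec u)) = 0 := by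
  have h := inner_mulVec_add_of_skew hJ u u
  rw [real_inner_comm u] at h
  linarith

theorem sub_of_isTrivialMotion {b : EuclideanSpace ℝ (Fin d)} {J : Matrix (Fin d) (Fin d) ℝ}
    {s : ℝ} (h : ∀ i, pos v i = b + WithLp.toLp 2 (J.mulVec (pos p i)) + s • pos p i)
    (i j : Fin n) : pos v i - pos v j =
      WithLp.toLp 2 (J.mulVec (pos p i - pos p j).ofLp) + s • (pos p i - pos p j) := by
  rw [h, h, WithLp.ofLp_sub, Matrix.mulVec_sub, WithLp.toLp_sub, smul_sub]
  abel

/-- The skew part of the velocity is orthogonal to `g 0`, so only the scaling part changes the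
length. -/
theorem hasDerivAt_norm_of_skew_add_smul {J : Matrix (Fin d) (Fin d) ℝ} (hJ : J.transpose = -J)
    {s : ℝ} {g : ℝ → EuclideanSpace ℝ (Fin d)} (h0 : g 0 ≠ 0)
    (hg : HasDerivAt g (WithLp.toLp 2 (J.mulVec (g 0).ofLp) + s • g 0) 0) :
    HasDerivAt (fun t => ‖g t‖) (s * ‖g 0‖) 0 := by
  have h1 := hg.norm_sq.sqrt (by simpa using h0)
  simp only [Real.sqrt_sq (norm_nonneg _)] at h1
  refine h1.congr_deriv ?_
  have h2 : ‖g 0‖ ≠ 0 := norm_ne_zero_iff.2 h0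
  rw [inner_add_right, inner_mulVec_self_of_skew hJ, inner_smul_right, real_inner_self_eq_norm_sq]
  field_simp
  ring

/-- Trivial motions are infinitesimal motions. -/
theorem IsTrivialMotion.weakRigidityMatrix_eq_zero (h : IsTrivialMotion E p v)
    (hp : p ∈ angleDomain d A) : weakRigidityMatrix E A p v = 0 := by
  obtain ⟨b, J, s, hJ, hs, hv⟩ := h
  have hsub := sub_of_isTrivialMotion hv
  rw [weakRigidityMatrix_eq_zero_iff hp]
  constructor
  · intro e he
    induction e using Sym2.ind with
    | _ i j =>
      rw [fderiv_sqLength_mk, hsub, hs ⟨_, he⟩, zero_smul, add_zero, inner_mulVec_self_of_skew hJ,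
        mul_zero]
  · intro a ha
    have n₁ := sub_ne_zero.2 (hp a ha).1.symm
    have n₂ := sub_ne_zero.2 (hp a ha).2.symm
    have h1 := (contDiffAt_cosAngle (m := 1) (hp a ha).1 (hp a ha).2).differentiableAt (by simp)
    have h2 := h1.hasFDerivAt.hasLineDerivAt v
    have g₁ := hasDerivAt_pos_sub p v a.2.1 a.1
    have g₂ := hasDerivAt_pos_sub p v a.2.2 a.1
    rw [hsub] at g₁ g₂
    have m₁ := hasDerivAt_norm_of_skew_add_smul hJ (s := s)
      (g := fun t : ℝ => pos (p + t • v) a.2.1 - pos (p + t • v) a.1) (by simpa using n₁)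
      (by simpa using g₁)
    have m₂ := hasDerivAt_norm_of_skew_add_smul hJ (s := s)
      (g := fun t : ℝ => pos (p + t • v) a.2.2 - pos (p + t • v) a.1) (by simpa using n₂)
      (by simpa using g₂)
    have h3 := (g₁.inner ℝ g₂).div (m₁.mul m₂) (by
      simpa using mul_ne_zero (norm_ne_zero_iff.2 n₁) (norm_ne_zero_iff.2 n₂))
    have h4 : HasDerivAt (fun t : ℝ => cosAngle (p + t • v) a) _ 0 :=
      h3.congr_of_eventuallyEq (Filter.Eventually.of_forall fun t => cosAngle_eq _ a)
    refine (HasDerivAt.unique h2 h4).trans ?_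
    have h5 := inner_mulVec_add_of_skew hJ (pos p a.2.1 - pos p a.1) (pos p a.2.2 - pos p a.1)
    -- In the numerator of the quotient rule the rotation contributes nothing, by `h5`. The inner
    -- product and the product of lengths both scale at rate `2 * s`, so these terms cancel.
    refine div_eq_zero_iff.2 (Or.inl ?_)
    simp only [zero_smul, add_zero, inner_add_left, inner_add_right, inner_smul_left,
      inner_smul_right, Pi.mul_apply, RCLike.conj_to_real]
    linear_combination (‖pos p a.2.1 - pos p a.1‖ * ‖pos p a.2.2 - pos p a.1‖) * h5

theorem isTrivialMotion_congr (h : E.Nonempty ↔ E'.Nonempty) :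
    IsTrivialMotion E p v ↔ IsTrivialMotion E' p v := by
  simp only [IsTrivialMotion, h]

/-- Keep the parameters `b`, `J`, `s` and let the configuration vary. -/
theorem exists_continuous_isTrivialMotion (h : IsTrivialMotion E q v) :
    ∃ u : Config n d → Config n d, Continuous u ∧ u q = v ∧ ∀ p, IsTrivialMotion E p (u p) := by
  obtain ⟨b, J, s, hJ, hs, hv⟩ := h
  refine ⟨fun p => WithLp.toLp 2 fun ic =>
    b ic.2 + J.mulVec (pos p ic.1) ic.2 + s * pos p ic.1 ic.2, ?_, ?_, ?_⟩
  · have hc : ∀ i c, Continuous (fun p : Config n d => pos p i c) := fun i c =>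
      (EuclideanSpace.proj (i, c) : Config n d →L[ℝ] ℝ).continuous
    refine (PiLp.continuous_toLp 2 _).comp (continuous_pi fun ic => ?_)
    have hJc : Continuous (fun p : Config n d => J.mulVec (pos p ic.1) ic.2) := by
      simp only [Matrix.mulVec, dotProduct]
      exact continuous_finsetSum _ fun c _ => continuous_const.mul (hc _ c)
    exact (continuous_const.add hJc).add (continuous_const.mul (hc _ _))
  · ext ic
    have := congrArg (fun w => w.ofLp ic.2) (hv ic.1)
    simpa [pos] using this.symm
  · intro p
    refine ⟨b, J, s, hJ, hs, fun i => ?_⟩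
    ext c
    simp [pos]

/-! ### Independence of constraints and minimal sub-frameworks -/

/-- The constraints of a minimally GIWR framework are independent. -/
theorem IsMinimallyGIWR.surjective (h : IsMinimallyGIWR E A p) (hp : p ∈ angleDomain d A) :
    Function.Surjective (weakRigidityMatrix E A p) := by
  obtain ⟨hg, hE, hA⟩ := h
  have hsingle : ∀ c : E ⊕ A, ∃ v, weakRigidityMatrix E A p v = EuclideanSpace.single c (1 : ℝ) := by
    intro c
    -- Such a `v` cannot lie in the kernel, by GIWR, so its image is a nonzero multiple of the basis
    -- vector at `c`.
    suffices ∃ v, ¬ IsTrivialMotion E p v ∧ ∀ c', c' ≠ c → weakRigidityMatrix E A p v c' = 0 by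
      obtain ⟨v, hv, hv'⟩ := this
      have hne : weakRigidityMatrix E A p v c ≠ 0 := by
        intro h0
        refine hv (hg v ?_)
        ext c'
        by_cases hc : c' = c
        · rw [hc, h0]
          rfl
        · exact hv' c' hc
      refine ⟨(weakRigidityMatrix E A p v c)⁻¹ • v, ?_⟩
      ext c'
      rw [map_smul, PiLp.smul_apply, smul_eq_mul]
      by_cases hc : c' = c
      · subst hc
        simp [inv_mul_cancel₀ hne]
      · simp [hv' c' hc, hc]
    rcases c with e | a
    · obtain ⟨v, hv, hnt⟩ := hE e e.2
      obtain ⟨h1, h2⟩ := (weakRigidityMatrix_eq_zero_iff hp).1 hv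
      refine ⟨v, hnt, fun c hc => ?_⟩
      rw [weakRigidityMatrix_apply hp]
      rcases c with e' | a'
      · exact h1 e' (Finset.mem_erase.2 ⟨fun h => hc (congrArg Sum.inl (Subtype.ext h)), e'.2⟩)
      · exact h2 a' a'.2
    · obtain ⟨v, hv, hnt⟩ := hA a a.2
      obtain ⟨h1, h2⟩ := (weakRigidityMatrix_eq_zero_iff
        (angleDomain_anti (Finset.erase_subset _ _) hp)).1 hv
      refine ⟨v, hnt, fun c hc => ?_⟩
      rw [weakRigidityMatrix_apply hp]
      rcases c with e' | a'
      · exact h1 e' e'.2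
      · exact h2 a' (Finset.mem_erase.2 ⟨fun h => hc (congrArg Sum.inr (Subtype.ext h)), a'.2⟩)
  choose w hw using hsingle
  intro x
  refine ⟨∑ c, x c • w c, ?_⟩
  simp only [map_sum, map_smul, hw]
  ext c
  simp [-Fintype.sum_sum_type, Pi.single_apply]

/-- The scaling motion of a GIWR framework with an edge is not trivial. -/
theorem not_isTrivialMotion_self_of_isGIWR (hd : 0 < d) (hE : ∀ e ∈ E, ¬ e.IsDiag)
    (hp : p ∈ angleDomain d A) (hg : IsGIWR E A p) (hne : E.Nonempty) :
    ¬ IsTrivialMotion E p p := by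
  rintro ⟨b, J, s, hJ, hs, hv⟩
  -- Without scaling, triviality gives `u = J u` for each difference `u` of positions, and `J u` is
  -- orthogonal to `u`: all points coincide.
  have hconst : ∀ i j, pos p i - pos p j = 0 := fun i j => by
    have h1 := sub_of_isTrivialMotion hv i j
    rw [hs hne, zero_smul, add_zero] at h1
    have h2 := inner_mulVec_self_of_skew hJ (pos p i - pos p j)
    rwa [← h1, inner_self_eq_zero] at h2
  have hker : ∀ v, weakRigidityMatrix E A p v = 0 := by
    intro v
    rw [weakRigidityMatrix_eq_zero_iff hp]
    refine ⟨fun e _ => ?_, fun a ha => absurd (sub_eq_zero.1 (hconst _ _)) (hp a ha).1⟩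
    induction e using Sym2.ind with
    | _ i j => rw [fderiv_sqLength_mk, hconst, inner_zero_left, mul_zero]
  obtain ⟨e, he⟩ := hne
  induction e using Sym2.ind with
  | _ i j =>
    have hij : i ≠ j := fun h => hE _ he (Sym2.mk_isDiag_iff.2 h)
    let c : Fin d := ⟨0, hd⟩
    -- Every motion is now infinitesimal, so moving one endpoint of an edge alone would be trivial;
    -- but trivial motions move coincident points equally.
    obtain ⟨b', J', s', -, hs', hv'⟩ := hg (EuclideanSpace.single (i, c) (1 : ℝ)) (hker _)
    have h1 := sub_of_isTrivialMotion hv' i j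
    rw [hconst, hs' ⟨_, he⟩] at h1
    have h2 := congrArg (fun w => w.ofLp c) h1
    simp [pos, hij.symm] at h2

/-- An inclusion-minimal choice works: a further removal that leaves the trivial motions unchanged
destroys GIWR. Removing the only edge is excluded from the competition and needs a separate motion.
-/
theorem exists_isMinimallyGIWRSub (hd : 0 < d) (hfw : IsFramework E A q) (hg : IsGIWR E A q) :
    ∃ E' A', IsMinimallyGIWRSub E A E' A' q := by
  obtain ⟨hE, -, hq⟩ := hfw
  let S : Finset (Sym2 (Fin n)) × Finset (Fin n × Fin n × Fin n) → Prop := fun B =>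
    B.1 ⊆ E ∧ B.2 ⊆ A ∧ (E.Nonempty → B.1.Nonempty) ∧ IsGIWR B.1 B.2 q
  obtain ⟨⟨E', A'⟩, ⟨hE', hA', hne, hg'⟩, hmin⟩ := exists_minimal_of_wellFoundedLT S
    ⟨(E, A), subset_rfl, subset_rfl, id, hg⟩
  have hq' := angleDomain_anti hA' hq
  refine ⟨E', A', hE', hA', hne, hg', fun e he => ?_, fun a ha => ?_⟩
  · by_cases hne' : (E'.erase e).Nonempty
    · have hng : ¬ IsGIWR (E'.erase e) A' q := fun h => by
        have := (hmin (y := (E'.erase e, A')) ⟨(Finset.erase_subset _ _).trans hE', hA',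
          fun _ => hne', h⟩ ⟨Finset.erase_subset _ _, le_rfl⟩).1
        exact Finset.notMem_erase e E' (this he)
      unfold IsGIWR at hng
      push Not at hng
      obtain ⟨v, hv, hnt⟩ := hng
      exact ⟨v, hv, fun h => hnt ((isTrivialMotion_congr (iff_of_true hne' ⟨e, he⟩)).2 h)⟩
    -- The last edge: once it is gone, the scaling `v = q` preserves all angles, yet it is not
    -- trivial for the framework with that edge.
    · refine ⟨q, IsTrivialMotion.weakRigidityMatrix_eq_zero ⟨0, 0, 1, by simp,
        fun h => absurd h hne', fun i => ?_⟩ hq', not_isTrivialMotion_self_of_isGIWR hd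
        (fun e he => hE e (hE' he)) hq' hg' ⟨e, he⟩⟩
      simp
  · have hng : ¬ IsGIWR E' (A'.erase a) q := fun h => by
      have := (hmin (y := (E', A'.erase a)) ⟨hE', (Finset.erase_subset _ _).trans hA', hne, h⟩
        ⟨le_rfl, Finset.erase_subset _ _⟩).2
      exact Finset.notMem_erase a A' (this ha)
    unfold IsGIWR at hng
    push Not at hng
    exact hng

/-! ### Error vectors and the error function -/

theorem contDiffAt_errorVec {m : WithTop ℕ∞} (hp : p ∈ angleDomain d A) :
    ContDiffAt ℝ m (errorVec E A q) p :=
  (contDiffAt_weakRigidityFun hp).sub contDiffAt_const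

theorem fderiv_errorVec : fderiv ℝ (errorVec E A q) p = weakRigidityMatrix E A p :=
  fderiv_sub_const _

theorem errorVec_self : errorVec E A q q = 0 :=
  sub_self _

theorem norm_sq_errorVec_eq_add (hE : E' ⊆ E) (hA : A' ⊆ A) (q p : Config n d) :
    ‖errorVec E A q p‖ ^ 2 = ‖errorVec E' A' q p‖ ^ 2 +
      ‖errorVec (E \ E') (A \ A') q p‖ ^ 2 := by
  have h : ∀ (B : Finset (Sym2 (Fin n))) (C : Finset (Fin n × Fin n × Fin n)),
      ‖errorVec B C q p‖ ^ 2 = ∑ e ∈ B, (sqLength p e - sqLength q e) ^ 2 +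
        ∑ a ∈ C, (cosAngle p a - cosAngle q a) ^ 2 := by
    intro B C
    rw [EuclideanSpace.real_norm_sq_eq, Fintype.sum_sum_type,
      ← Finset.sum_coe_sort B, ← Finset.sum_coe_sort C]
    rfl
  rw [h, h, h, ← Finset.sum_sdiff hE, ← Finset.sum_sdiff hA]
  ring

/-- The squared error is a sum over constraints, so it splits into the sub-framework part and the
rest. -/
theorem gradient_half_norm_sq_errorVec (hE : E' ⊆ E) (hA : A' ⊆ A) (hp : p ∈ angleDomain d A) :
    gradient (fun x : Config n d => (1 / 2 : ℝ) * ‖errorVec E A q x‖ ^ 2) p =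
      ContinuousLinearMap.adjoint (weakRigidityMatrix E' A' p) (errorVec E' A' q p) +
      ContinuousLinearMap.adjoint (weakRigidityMatrix (E \ E') (A \ A') p)
        (errorVec (E \ E') (A \ A') q p) := by
  have hder : ∀ (B : Finset (Sym2 (Fin n))) (C : Finset (Fin n × Fin n × Fin n)), C ⊆ A →
      HasFDerivAt (errorVec B C q) (weakRigidityMatrix B C p) p := fun B C hC => by
    rw [← fderiv_errorVec (q := q)]
    exact ((contDiffAt_errorVec (m := 1) (angleDomain_anti hC hp)).differentiableAt
      (by simp)).hasFDerivAt
  refine HasGradientAt.gradient (hasGradientAt_iff_hasFDerivAt.2 ?_)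
  simp only [norm_sq_errorVec_eq_add hE hA]
  have h := ((hder E' A' hA).norm_sq.add
    (hder (E \ E') (A \ A') Finset.sdiff_subset).norm_sq).const_mul (1 / 2 : ℝ)
  refine h.congr_fderiv ?_
  ext1 v
  simp [ContinuousLinearMap.adjoint_inner_left]

theorem exists_isErrorFunction (hq : q ∈ angleDomain d A)
    (h : IsMinimallyGIWRSub E A E' A' q) :
    ∃ f : ErrorSpace E' A' → ErrorSpace (E \ E') (A \ A'), IsErrorFunction E A E' A' q f := by
  obtain ⟨hE, hA, hne, hmin⟩ := h
  have hiff : E'.Nonempty ↔ E.Nonempty := ⟨fun h => h.mono hE, hne⟩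
  have hq' := angleDomain_anti hA hq
  -- Analyticity at a point spreads to a neighbourhood, whereas `ContDiffAt ℝ ∞` at one point need
  -- not; this yields the open set `U` below.
  have ha : ContDiffAt ℝ ω (errorVec E' A' q) q := contDiffAt_errorVec hq'
  have hb : ContDiffAt ℝ ω (errorVec (E \ E') (A \ A') q) q :=
    contDiffAt_errorVec (angleDomain_anti Finset.sdiff_subset hq)
  have hker : ∀ᶠ y in nhds q, ∀ v, fderiv ℝ (errorVec E' A' q) y v = 0 →
      fderiv ℝ (errorVec (E \ E') (A \ A') q) y v = 0 := by
    refine eventually_ker_le_of_continuousAt_sections (R := fderiv ℝ (errorVec E' A' q))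
      (S := fderiv ℝ (errorVec (E \ E') (A \ A') q))
      (ha.fderiv_right (m := 0) (by simp)).continuousAt ?_ ?_
    · rw [fderiv_errorVec]
      exact hmin.surjective hq'
    · intro w hw
      rw [fderiv_errorVec] at hw
      obtain ⟨u, huc, huq, hut⟩ := exists_continuous_isTrivialMotion (hmin.1 w hw)
      refine ⟨u, huc.continuousAt, huq, ?_⟩
      filter_upwards [(isOpen_angleDomain A).mem_nhds hq] with y hy
      have h1 := (hut y).weakRigidityMatrix_eq_zero (angleDomain_anti hA hy)
      -- `E` and `E'` are both empty or both nonempty, so the same motion is trivial for the full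
      -- framework and killed by all its constraints.
      have h2 := ((isTrivialMotion_congr hiff).1 (hut y)).weakRigidityMatrix_eq_zero hy
      refine ⟨by rw [fderiv_errorVec, h1], ?_⟩
      rw [weakRigidityMatrix_eq_zero_iff hy] at h2
      rw [fderiv_errorVec, weakRigidityMatrix_eq_zero_iff (angleDomain_anti Finset.sdiff_subset hy)]
      exact ⟨fun e he => h2.1 e (Finset.sdiff_subset he), fun a ha => h2.2 a (Finset.sdiff_subset ha)⟩
  obtain ⟨f, hf, hbf⟩ := exists_contDiffAt_eventually_eq_comp_of_ker_le (n := ω) (by simp) ha hb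
    (by rw [fderiv_errorVec]; exact hmin.surjective hq') hker
  rw [errorVec_self] at hf
  refine ⟨f, ?_, hbf⟩
  obtain ⟨U, hU, hUo, h0⟩ := eventually_nhds_iff.1 (hf.eventually (by simp))
  exact ⟨U, hUo, h0, fun x hx => ((hU x hx).of_le (by simp)).contDiffWithinAt⟩

end Framework

/-! ### The main theorem -/

theorem mainTheorem8 {n d : ℕ} (hd : d = 2 ∨ d = 3)
    (E : Finset (Sym2 (Fin n))) (A : Finset (Fin n × Fin n × Fin n)) (q : Config n d)
    (hfw : IsFramework E A q) (hgiwr : IsGIWR E A q) (hnonmin : ¬ IsMinimallyGIWR E A q) :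
    (∃ E' A', IsMinimallyGIWRSub E A E' A' q) ∧
    ∀ (E' : Finset (Sym2 (Fin n))) (A' : Finset (Fin n × Fin n × Fin n)),
      IsMinimallyGIWRSub E A E' A' q →
      -- the remaining errors are locally a smooth function of the errors of the sub-framework
      (∃ f : ErrorSpace E' A' → ErrorSpace (E \ E') (A \ A'), IsErrorFunction E A E' A' q f) ∧
      -- the perturbed error system has an exponentially stable equilibrium at the origin
      ∀ f : ErrorSpace E' A' → ErrorSpace (E \ E') (A \ A'), IsErrorFunction E A E' A' q f →
        f 0 = 0 ∧
        ∃ δ > 0, ∃ K > 0, ∃ r > 0, ∃ V ∈ nhds q,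
          (∀ x₀ : ErrorSpace E' A', ‖x₀‖ < δ → ∃ p₀ ∈ V, errorVec E' A' q p₀ = x₀) ∧
          ∀ p₀ ∈ V,
            (∃ p : ℝ → Config n d, p 0 = p₀ ∧ IsGradientFlow E A q p) ∧
            ∀ p : ℝ → Config n d, p 0 = p₀ → IsGradientFlow E A q p →
              (∀ t, 0 ≤ t →
                p t ∈ angleDomain d A ∧
                errorVec (E \ E') (A \ A') q (p t) = f (errorVec E' A' q (p t)) ∧
                HasDerivWithinAt (fun s => errorVec E' A' q (p s))
                  (perturbedField E A E' A' f (p t) (errorVec E' A' q (p t))) (Set.Ici 0) t ∧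
                ‖errorVec E' A' q (p t)‖ ≤ K * ‖errorVec E' A' q p₀‖ * Real.exp (-r * t)) ∧
              IsExpStableAtOrigin
                (fun t x => perturbedField E A E' A' f (p t) x) δ K r := by
  refine ⟨exists_isMinimallyGIWRSub (by omega) hfw hgiwr, fun E' A' hsub => ?_⟩
  have hq := hfw.2.2
  refine ⟨exists_isErrorFunction hq hsub, fun f hf => ?_⟩
  obtain ⟨hE, hA, -, hmin⟩ := hsub
  obtain ⟨⟨U, hU, h0, hfU⟩, hbf⟩ := hf
  have hf0 : f 0 = 0 := by
    have := hbf.self_of_nhds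
    rwa [errorVec_self, errorVec_self, eq_comm] at this
  refine ⟨hf0, ?_⟩
  -- Confinement to this neighbourhood keeps the angles defined and the error relation valid for all
  -- time.
  have hN : {y | y ∈ angleDomain d A ∧
      errorVec (E \ E') (A \ A') q y = f (errorVec E' A' q y)} ∈ nhds q :=
    Filter.inter_mem ((isOpen_angleDomain A).mem_nhds hq) hbf
  have main := exists_expStable_of_submersion (f := f)
    (G := fun y => -gradient (fun x : Config n d => (1 / 2 : ℝ) * ‖errorVec E A q x‖ ^ 2) y)
    (contDiffAt_errorVec (angleDomain_anti hA hq))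
    (contDiffAt_errorVec (angleDomain_anti Finset.sdiff_subset hq))
    ((hfU.contDiffAt (hU.mem_nhds h0)).of_le (by simp)) errorVec_self hf0
    (by rw [fderiv_errorVec]; exact hmin.surjective (angleDomain_anti hA hq)) hbf
    (by
      filter_upwards [(isOpen_angleDomain A).mem_nhds hq] with y hy
      rw [gradient_half_norm_sq_errorVec hE hA hy, fderiv_errorVec, fderiv_errorVec]) hN
  simp only [fderiv_errorVec] at main
  obtain ⟨δ, hδ, K, hK, r, hr, V, hV, hball, hflow⟩ := main
  refine ⟨δ, hδ, K, hK, r, hr, V, hV, hball, fun p₀ hp₀ => ⟨(hflow p₀ hp₀).1, fun p hp0 hp => ?_⟩⟩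
  obtain ⟨h1, h2⟩ := (hflow p₀ hp₀).2 p hp0 hp
  exact ⟨fun t ht => ⟨(h1 t ht).1.1, (h1 t ht).1.2, (h1 t ht).2⟩, h2⟩
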